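/- Let $\pi:V\to W$ be a surjective linear map of finite-dimensional real vector spaces, $P\subset V$ a full-dimensional polytope, $Q=\pi(P)$, and let $\pi^\vee:V^*\to(\ker\pi)^*$ be the restriction map. Faces of $P$ are nonempty; $N(P,F)\subset V^*$ is the closed normal cone of a face $F$ (the linear functions whose maximum on $P$ is attained at every point of $F$), and $\Delta(P)=\{N(P,F)\}$. For $q\in Q$ the cell $[q]$ is the intersection of all $\pi(F)$ ($F$ a face of $P$) containing $q$, and $\Gamma$ is the set of cells; for $\psi\in(\ker\pi)^*$ the cone $[\psi]$ is the intersection of all $\pi^\vee N(P,F)$ containing $\psi$, and $\Gamma^*$ is the set of these cones. Both are ordered by inclusion. Let $P_q=P\cap\pi^{-1}(q)$, let $P_q^\psi$ be the face of $P_q$ on which $\psi$ is maximal, and $F_{q,\psi}$ the smallest face of $P$ containing $P_q^\psi$; it depends only on the cell $c$ with $q\in\operatorname{relint}c$ and on the cone $\sigma\in\Gamma^*$ with $\psi\in\operatorname{relint}\sigma$, so one also writes $F_{c,\psi}$, $F_{q,\sigma}$. Let $[\psi]_c$ be the smallest cone containing $\psi$ in the normal fan of $P_q$, $q\in\operatorname{relint}c$,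 and let $[q]_\sigma$ be the smallest set containing $q$ among the $\pi(F_{p,\sigma})$, $p\in Q$. - A map $\Psi:\Gamma\to(\ker\pi)^*$ is coherent if $\operatorname{relint}[\Psi(c)]_c\subset\operatorname{relint}[\Psi(c')]_{c'}$ whenever $c'\subset c$. For coherent $\Psi$, $\mathcal F(\Psi)=\{F_{c,\Psi(c)}\mid c\in\Gamma\}$ is a locally coherent string and $\mathcal C(\Psi)=\{N(P,F_{c,\Psi(c)})\mid c\in\Gamma\}$ is a virtual cone. - A map $\kappa:\Gamma^*\to Q$ is coherent if $\operatorname{relint}[\kappa(\sigma)]_\sigma\subset\operatorname{relint}[\kappa(\sigma')]_{\sigma'}$ whenever $\sigma'\subset\sigma$. For coherent $\kappa$, $\mathcal F(\kappa)=\{F_{\kappa(\sigma),\sigma}\mid\sigma\in\Gamma^*\}$ is a virtual cell. - A locally coherent costring is a set $\mathcal C\subset\Delta(P)$ such that $C\mapsto\pi^\vee(C)$ is injective on $\mathcal C$, the $\pi^\vee(C)$, $C\in\mathcal C$, form a finite fan of polyhedral cones (closed under faces, any two meeting in a common face, lineality allowed) with support $(\ker\pi)^*$, and, for $C,D\in\mathcal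 C$, $\pi^\vee(C)\subset\pi^\vee(D)$ if and only if $C=(\pi^\vee)^{-1}(\pi^\vee(C))\cap D$. Let $\mathcal T,\Gamma^*_{vir},\Gamma_{vir},\mathcal T^*$ be the sets of locally coherent strings, virtual cones, virtual cells, locally coherent costrings. Order $\mathcal T$ and $\mathcal T^*$ by inclusion of the unions of their members. Order $\Gamma^*_{vir}$ by $\mathcal C(\Psi)\le\mathcal C(\Phi)$ iff $N(P,F_{c,\Psi(c)})\subset N(P,F_{c,\Phi(c)})$ for all $c\in\Gamma$, and $\Gamma_{vir}$ by $\mathcal F(\kappa)\le\mathcal F(\mu)$ iff $F_{\kappa(\sigma),\sigma}\subset F_{\mu(\sigma),\sigma}$ for all $\sigma\in\Gamma^*$. **Theorem A.** 1. A collection $\mathcal F$ of faces of $P$ is a locally coherent string if and only if $\{N(P,F)\mid F\in\mathcal F\}$ is a virtual cone. 2. A collection $\mathcal F$ of faces of $P$ is a virtual cell if and only if $\{N(P,F)\mid F\in\mathcal F\}$ is a locally coherent costring. 3. A collection $\mathcal C\subset\Delta(P)$ is a locally coherent costring if and only if $\{F\mid N(P,F)\in\mathcal C\}$ is a virtual cell.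 4. A collection $\mathcal C\subset\Delta(P)$ is a virtual cone if and only if $\{F\mid N(P,F)\in\mathcal C\}$ is a locally coherent string. The four relations above are partial orders, and each of these correspondences is an order-reversing bijection (in both directions), so $\mathcal T\cong(\Gamma^*_{vir})^{op}$ and $\mathcal T^*\cong(\Gamma_{vir})^{op}$. The first extends the anti-isomorphism $\sigma\mapsto\mathcal F(\sigma)=\{F_{q,\sigma}\mid q\in Q\}$ of $\Gamma^*$ onto the set $\mathcal T_{coh}\subset\mathcal T$ of coherent strings $\{F_{c,\psi}\mid c\in\Gamma\}$, $\psi\in(\ker\pi)^*$: sending $\sigma$ to the virtual cone of a constant map with value in $\operatorname{relint}\sigma$ embeds the poset $\Gamma^*$ in $\Gamma^*_{vir}$, and this virtual cone corresponds to $\mathcal F(\sigma)$. The second extends the anti-isomorphism $c\mapsto\Delta(c)=\{N(P,F_{c,\psi})\mid\psi\in(\ker\pi)^*\}$ of $\Gamma$ onto the set $\mathcal T^*_{coh}\subset\mathcal T^*$ of coherent costrings: sending $c$ to the virtual cell of a constant map with value in $\operatorname{relint}c$ embeds the poset $\Gamma$ in $\Gamma_{vir}$, and this virtual cell corresponds to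 $\Delta(c)$. -/

import Mathlib

/-! Projections of polytopes and of their normal fans.

Throughout `π : V → W` is a linear map of finite dimensional real vector spaces, `P ⊆ V` is a
polytope and `Q = π(P)`.  Dual spaces carry their usual topology and `relint` is Mathlib's
`intrinsicInterior ℝ`. -/

open Set

namespace FanDuality

section Orders

variable {α β : Type*}

/-- `r` restricts to a partial order on `A`. -/
structure IsPartialOrderOn (A : Set α) (r : α → α → Prop) : Prop where
  refl : ∀ a ∈ A, r a a
  trans : ∀ a ∈ A, ∀ b ∈ A, ∀ c ∈ A, r a b → r b c → r a c
  antisymm : ∀ a ∈ A, ∀ b ∈ A, r a b → r b a → a = b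

/-- `f` is an anti-isomorphism from the poset `(A, r)` onto the poset `(B, s)`. -/
structure IsAntiIsoOn (f : α → β) (A : Set α) (r : α → α → Prop)
    (B : Set β) (s : β → β → Prop) : Prop where
  bijOn : BijOn f A B
  rev : ∀ a ∈ A, ∀ a' ∈ A, (r a a' ↔ s (f a') (f a))

/-- `f` embeds the poset `(A, r)` into the poset `(B, s)`. -/
structure IsEmbeddingOn (f : α → β) (A : Set α) (r : α → α → Prop)
    (B : Set β) (s : β → β → Prop) : Prop where
  mapsTo : MapsTo f A B
  injOn : InjOn f A
  iff : ∀ a ∈ A, ∀ a' ∈ A, (r a a' ↔ s (f a) (f a'))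

/-- Collections of sets compared by inclusion of their unions. -/
def UnionLE (A B : Set (Set α)) : Prop := ⋃₀ A ⊆ ⋃₀ B

end Orders

section Polyhedra

variable {E : Type*} [NormedAddCommGroup E] [NormedSpace ℝ E]

/-- A polytope: the convex hull of a finite nonempty set. -/
def IsPolytope (P : Set E) : Prop :=
  ∃ S : Set E, S.Finite ∧ S.Nonempty ∧ P = convexHull ℝ S

/-- A polyhedral cone: the set of nonnegative combinations of finitely many vectors. -/
def IsPolyhedralCone (C : Set E) : Prop :=
  ∃ K : PointedCone ℝ E, K.FG ∧ (K : Set E) = C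

/-- `G` is a nonempty face of the convex set `C`: the set of points of `C` at which some linear
function is maximal on `C`. -/
def IsFace (C G : Set E) : Prop :=
  G.Nonempty ∧ ∃ l : E →L[ℝ] ℝ, G = l.toExposed C

/-- The nonempty faces of `P`. -/
def faces (P : Set E) : Set (Set E) := {F | IsFace P F}

/-- The (closed) normal cone `N(P, F)`: the linear functions that are maximal on `P` at every
point of `F`. -/
def normalCone (P F : Set E) : Set (E →L[ℝ] ℝ) := {l | F ⊆ l.toExposed P}

/-- The normal fan `Δ(P)`. -/
def normalFan (P : Set E) : Set (Set (E →L[ℝ] ℝ)) := normalCone P '' faces P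

/-- `K` is a subdivision of `X` into cones: a finite fan (whose cones need not be strongly
convex) with support `X`. -/
structure IsConeSubdivision (K : Set (Set E)) (X : Set E) : Prop where
  finite : K.Finite
  polyhedral : ∀ C ∈ K, IsPolyhedralCone C
  face_mem : ∀ C ∈ K, ∀ G, IsFace C G → G ∈ K
  inter_face : ∀ C ∈ K, ∀ D ∈ K, IsFace C (C ∩ D) ∧ IsFace D (C ∩ D)
  support : ⋃₀ K = X

end Polyhedra

section Projection

variable {V W : Type*} [NormedAddCommGroup V] [NormedSpace ℝ V]
  [NormedAddCommGroup W] [NormedSpace ℝ W]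

/-- `(ker π)^*`. -/
abbrev KerDual (π : V →L[ℝ] W) : Type _ := (LinearMap.ker π.toLinearMap) →L[ℝ] ℝ

/-- `π^∨ : V^* → (ker π)^*`, the restriction of linear functions to `ker π`. -/
def dualProj (π : V →L[ℝ] W) (l : V →L[ℝ] ℝ) : KerDual π :=
  l.comp (LinearMap.ker π.toLinearMap).subtypeL

variable (P : Set V) (π : V →L[ℝ] W)

/-- The cell `[q]` of a point `q`: the intersection of the `π`-images of all faces of `P` whose
image contains `q`. -/
def cellOf (q : W) : Set W := ⋂₀ {D | ∃ F ∈ faces P, D = π '' F ∧ q ∈ D}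

/-- `Γ(P, Q)`: the cells of the points of `Q`. -/
def cells : Set (Set W) := cellOf P π '' (π '' P)

/-- The cone `[ψ]` of `ψ ∈ (ker π)^*`: the intersection of the `π^∨`-images of all cones of the
normal fan whose image contains `ψ`. -/
def coneOf (ψ : KerDual π) : Set (KerDual π) :=
  ⋂₀ {D | ∃ F ∈ faces P, D = dualProj π '' normalCone P F ∧ ψ ∈ D}

/-- `Γ^*(P, Q)`. -/
def cones : Set (Set (KerDual π)) := range (coneOf P π)

/-- The face `P_q^ψ` of the fibre `P_q = P ∩ π⁻¹(q)` on which `ψ ∈ (ker π)^*` is maximal.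
(On `P_q` the function `ψ` is defined up to a constant; it compares the points `x` and `x + k`
by the sign of `ψ k`.) -/
def fiberFace (q : W) (ψ : KerDual π) : Set V :=
  {x | x ∈ P ∧ π x = q ∧ ∀ k : LinearMap.ker π.toLinearMap, x + (k : V) ∈ P → ψ k ≤ 0}

/-- The normal cone in `(ker π)^*` of a subset `G` of the fibre `P_q`. -/
def fiberNormalCone (q : W) (G : Set V) : Set (KerDual π) := {ψ | G ⊆ fiberFace P π q ψ}

/-- The normal fan `Δ(P_q)` of the fibre `P_q`, in `(ker π)^*`. -/
def fiberFan (q : W) : Set (Set (KerDual π)) :=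
  {C | ∃ ψ : KerDual π, C = fiberNormalCone P π q (fiberFace P π q ψ)}

/-- The minimal cone of the normal fan `Δ(P_q)` that contains `ψ`. For `q` in the relative
interior of a cell `c` this is the cone `[ψ]_c`. -/
def fiberConeOf (q : W) (ψ : KerDual π) : Set (KerDual π) :=
  ⋂₀ {C | C ∈ fiberFan P π q ∧ ψ ∈ C}

/-- `F_{q,ψ}`: the smallest face of `P` that contains `P_q^ψ`. It depends only on the cell whose
relative interior contains `q` and the cone whose relative interior contains `ψ`; so
`F_{c,ψ} = F_{q,ψ}` for all `q ∈ relint c`, and `F_{q,σ} = F_{q,ψ}` for all `ψ ∈ relint σ`. -/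
def minFace (q : W) (ψ : KerDual π) : Set V :=
  ⋂₀ {F | F ∈ faces P ∧ fiberFace P π q ψ ⊆ F}

/-! ### Maps `Γ → (ker π)^*`: strings and virtual cones -/

/-- The collection `{F_{c,Ψ(c)} | c ∈ Γ}` of faces of `P`. -/
def stringOf (Ψ : cells P π → KerDual π) : Set (Set V) :=
  {F | ∃ c : cells P π, ∃ q ∈ intrinsicInterior ℝ (c : Set W), F = minFace P π q (Ψ c)}

/-- The collection `{N(P, F_{c,Ψ(c)}) | c ∈ Γ}` of cones of the normal fan. -/
def virtualConeOf (Ψ : cells P π → KerDual π) : Set (Set (V →L[ℝ] ℝ)) :=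
  {C | ∃ c : cells P π, ∃ q ∈ intrinsicInterior ℝ (c : Set W),
    C = normalCone P (minFace P π q (Ψ c))}

/-- Local coherence of `Ψ : Γ → (ker π)^*`:
`relint [Ψ(c)]_c ⊆ relint [Ψ(c')]_{c'}` whenever `c' ≤ c`. -/
def IsCoherentOnCells (Ψ : cells P π → KerDual π) : Prop :=
  ∀ c c' : cells P π, (c' : Set W) ⊆ c →
    ∀ q ∈ intrinsicInterior ℝ (c : Set W), ∀ q' ∈ intrinsicInterior ℝ (c' : Set W),
      intrinsicInterior ℝ (fiberConeOf P π q (Ψ c)) ⊆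
        intrinsicInterior ℝ (fiberConeOf P π q' (Ψ c'))

/-- The set `T(P, Q)` of locally coherent strings, ordered by `UnionLE`. -/
def strings : Set (Set (Set V)) :=
  {A | ∃ Ψ : cells P π → KerDual π, IsCoherentOnCells P π Ψ ∧ A = stringOf P π Ψ}

/-- The set `Γ^*_vir(P, Q)` of virtual cones. -/
def virtualCones : Set (Set (Set (V →L[ℝ] ℝ))) :=
  {A | ∃ Ψ : cells P π → KerDual π, IsCoherentOnCells P π Ψ ∧ A = virtualConeOf P π Ψ}

/-- The order of virtual cones: inclusion, for every `c ∈ Γ`, of the cones attached to `c`. -/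
def VirtualConeLE (A B : Set (Set (V →L[ℝ] ℝ))) : Prop :=
  ∃ Ψ Φ : cells P π → KerDual π,
    IsCoherentOnCells P π Ψ ∧ A = virtualConeOf P π Ψ ∧
    IsCoherentOnCells P π Φ ∧ B = virtualConeOf P π Φ ∧
    ∀ c : cells P π, ∀ q ∈ intrinsicInterior ℝ (c : Set W),
      normalCone P (minFace P π q (Ψ c)) ⊆ normalCone P (minFace P π q (Φ c))

/-- The coherent string `𝓕(ψ) = {F_{c,ψ} | c ∈ Γ}`. -/
def coherentString (ψ : KerDual π) : Set (Set V) := stringOf P π fun _ => ψ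

/-- The set `T_coh(P, Q)` of coherent strings, ordered by `UnionLE`. -/
def coherentStrings : Set (Set (Set V)) := range (coherentString P π)

/-- The coherent string `𝓕(σ)` of a cone `σ`: the coherent string of the points of `relint σ`. -/
def stringOfCone (σ : Set (KerDual π)) : Set (Set V) :=
  ⋃ ψ ∈ intrinsicInterior ℝ σ, coherentString P π ψ

/-- A cone `σ` as a virtual cone: the one of the constant map with a value in `relint σ`. -/
def virtualConeOfCone (σ : Set (KerDual π)) : Set (Set (V →L[ℝ] ℝ)) :=
  ⋃ ψ ∈ intrinsicInterior ℝ σ, virtualConeOf P π fun _ => ψ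

/-! ### Maps `Γ^* → Q`: virtual cells; and costrings -/

/-- The minimal cell of the subdivision `{π(F) | F ∈ 𝓕(ψ)}` of `Q` that contains `q`. For `ψ` in
the relative interior of a cone `σ` this is `[q]_σ`. -/
def stringCellOf (q : W) (ψ : KerDual π) : Set W :=
  ⋂₀ {D | ∃ F ∈ coherentString P π ψ, D = π '' F ∧ q ∈ D}

/-- The collection `{F_{κ(σ),σ} | σ ∈ Γ^*}` of faces of `P`. -/
def virtualCellOf (κ : cones P π → π '' P) : Set (Set V) :=
  {F | ∃ σ : cones P π, ∃ ψ ∈ intrinsicInterior ℝ (σ : Set (KerDual π)),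
    F = minFace P π (κ σ) ψ}

/-- Local coherence of `κ : Γ^* → Q`:
`relint [κ(σ)]_σ ⊆ relint [κ(σ')]_{σ'}` whenever `σ' ≤ σ`. -/
def IsCoherentOnCones (κ : cones P π → π '' P) : Prop :=
  ∀ σ σ' : cones P π, (σ' : Set (KerDual π)) ⊆ σ →
    ∀ ψ ∈ intrinsicInterior ℝ (σ : Set (KerDual π)),
    ∀ ψ' ∈ intrinsicInterior ℝ (σ' : Set (KerDual π)),
      intrinsicInterior ℝ (stringCellOf P π (κ σ) ψ) ⊆
        intrinsicInterior ℝ (stringCellOf P π (κ σ') ψ')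

/-- The set `Γ_vir(P, Q)` of virtual cells. -/
def virtualCells : Set (Set (Set V)) :=
  {A | ∃ κ : cones P π → π '' P, IsCoherentOnCones P π κ ∧ A = virtualCellOf P π κ}

/-- The order of virtual cells: inclusion, for every `σ ∈ Γ^*`, of the faces attached to `σ`. -/
def VirtualCellLE (A B : Set (Set V)) : Prop :=
  ∃ κ μ : cones P π → π '' P,
    IsCoherentOnCones P π κ ∧ A = virtualCellOf P π κ ∧
    IsCoherentOnCones P π μ ∧ B = virtualCellOf P π μ ∧
    ∀ σ : cones P π, ∀ ψ ∈ intrinsicInterior ℝ (σ : Set (KerDual π)),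
      minFace P π (κ σ) ψ ⊆ minFace P π (μ σ) ψ

/-- A cell `c` as a virtual cell: the one of the constant map with a value in `relint c`. -/
def virtualCellOfCell (c : Set W) : Set (Set V) :=
  {F | ∃ q ∈ intrinsicInterior ℝ c, ∃ hq : q ∈ π '' P, F ∈ virtualCellOf P π fun _ => ⟨q, hq⟩}

/-- `C` is a locally coherent costring of `π^∨ : |D| → π^∨(|D|)`, where `D` is a fan in `V^*`. -/
structure IsCostring (D C : Set (Set (V →L[ℝ] ℝ))) : Prop where
  subset : C ⊆ D
  /-- The images of the members form a cone subdivision of `π^∨(|D|)` … -/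
  subdivision : IsConeSubdivision ((fun s => dualProj π '' s) '' C) (dualProj π '' ⋃₀ D)
  /-- … without repetition. -/
  noRepetition : InjOn (fun s => dualProj π '' s) C
  lift : ∀ s ∈ C, ∀ t ∈ C, (dualProj π '' s ⊆ dualProj π '' t ↔
    s = dualProj π ⁻¹' (dualProj π '' s) ∩ t)

/-- The set `T^*(P, Q)` of locally coherent costrings of `π^∨ : |Δ(P)| → (ker π)^*`, ordered by
`UnionLE`. -/
def costrings : Set (Set (Set (V →L[ℝ] ℝ))) := {C | IsCostring π (normalFan P) C}

/-- The coherent costring `Δ(q) = {N(P, F_{q,ψ}) | ψ ∈ (ker π)^*}`. -/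
def coherentCostring (q : W) : Set (Set (V →L[ℝ] ℝ)) :=
  range fun ψ : KerDual π => normalCone P (minFace P π q ψ)

/-- The set `T^*_coh(P, Q)` of coherent costrings, ordered by `UnionLE`. -/
def coherentCostrings : Set (Set (Set (V →L[ℝ] ℝ))) := coherentCostring P π '' (π '' P)

/-- The coherent costring `Δ(c)` of a cell `c`: the coherent costring of the points of
`relint c`. -/
def costringOfCell (c : Set W) : Set (Set (V →L[ℝ] ℝ)) :=
  ⋃ q ∈ intrinsicInterior ℝ c, coherentCostring P π q

/-- The collection `{N(P, F) | F ∈ A}` of normal cones of a collection `A` of faces. -/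
def conesOf (A : Set (Set V)) : Set (Set (V →L[ℝ] ℝ)) := normalCone P '' A

/-- The collection `{F | N(P, F) ∈ C}` of faces of a collection `C` of normal cones. -/
def facesOf (C : Set (Set (V →L[ℝ] ℝ))) : Set (Set V) := {F | F ∈ faces P ∧ normalCone P F ∈ C}

end Projection

end FanDuality

namespace FanDuality

/-! ### Relative interiors: prolongation of segments, linear images, finite intersections -/

section RelativeInterior

variable {E E' : Type*} [NormedAddCommGroup E] [NormedSpace ℝ E]
  [NormedAddCommGroup E'] [NormedSpace ℝ E']

/-! Everything rests on strict complementarity in linear programming. For `q ∈ Q` and `ψ ∈ (ker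
π)^*`, the face `F_{q,ψ}` is the only face `F` of `P` with `q ∈ relint π(F)` and `ψ ∈ relint π^∨
N(P,F)` (`mem_ri_dualProj_normalCone_minFace`, `facePairing`). The products of these relative
interiors therefore partition `Q × (ker π)^*`. This picture is symmetric in the two factors, so it
is axiomatised as `FacePairing`, and each statement about maps `Γ → (ker π)^*` gives one about maps
`Γ^* → Q` through `FacePairing.swap`.

In these terms a map `Ψ`, regarded as a function of points, is coherent when `F_{p,Ψ(q)} =
F_{p,Ψ(p)}` for all `p ∈ [q]`. Points near `p` have cells containing `p`, so a connectedness
argument shows that `F_{q,Ψ(q)}` is constant on the relative interior of its own image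
(`Coherent.F_eq_of_mem_ri`). Hence the collection of faces determines the face over each point, and
if `p ∈ π(F_{q,Ψ(q)})`, one `ψ` serves both `F_{q,Ψ(q)}` and `F_{p,Ψ(p)}`
(`Coherent.exists_common`).

Strings and virtual cones come from the same maps `Ψ`, and `F ↦ N(P,F)` is injective on faces; only
their orders need comparison. Over `q` the union of a string is `F_{q,Ψ(q)} ∩ π⁻¹(q)`, so inclusion
of unions is inclusion of faces over every `q`, that is, reverse inclusion of normal cones. Virtual
cells and the unions of their normal cones are compared in the same way.

The substantial point is that costrings, defined geometrically, are the families of normal cones of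
virtual cells. For faces `F ⊆ G`, if the relative interiors of `π(F)` and `π(G)` meet, a vector of
`ker π` joining relative interior points of `F` and `G` exposes `π^∨ N(P,G)` as a face of `π^∨
N(P,F)` (`isFace_dualProj_image`). Conversely, such an exposing vector, together with the lifting
condition, moves `relint F` into `relint G` along the fibres
(`ri_image_subset_of_isFace_dualProj_image`). Constant maps give the coherent objects. -/

theorem exists_add_smul_mem_of_mem_intrinsicInterior {C : Set E} {x y : E}
    (hx : x ∈ intrinsicInterior ℝ C) (hy : y ∈ C) : ∃ ε > (0 : ℝ), x + ε • (x - y) ∈ C := by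
  obtain ⟨⟨x, hxs⟩, hxi, rfl⟩ := mem_intrinsicInterior.1 hx
  have hmem : ∀ t : ℝ, x + t • (x - y) ∈ affineSpan ℝ C := fun t => by
    have := AffineMap.lineMap_mem (-t) hxs (subset_affineSpan ℝ C hy)
    rwa [AffineMap.lineMap_apply_module', show -t • (y - x) + x = x + t • (x - y) by module]
      at this
  let g : ℝ → affineSpan ℝ C := fun t => ⟨x + t • (x - y), hmem t⟩
  have hg : Continuous g := by
    refine Continuous.subtype_mk ?_ _
    fun_prop
  have h0 : g 0 = ⟨x, hxs⟩ := by simp [g]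
  have hnhds := hg.continuousAt.preimage_mem_nhds (x := 0)
    (by rw [h0]; exact mem_interior_iff_mem_nhds.1 hxi)
  obtain ⟨ε, hε, hball⟩ := Metric.mem_nhds_iff.1 hnhds
  refine ⟨ε / 2, by positivity, ?_⟩
  have : ε / 2 ∈ Metric.ball (0 : ℝ) ε := by
    rw [mem_ball_zero_iff, Real.norm_eq_abs, abs_of_pos (by positivity)]
    linarith
  exact hball this

/-- The homothety of the affine span with centre `w` and ratio `1/r` sends the new point to `z`. A
neighbourhood of `z` in `C` pulls back to one of the new point, contained in `C` by convexity. -/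
theorem add_smul_mem_intrinsicInterior {C : Set E} (hC : Convex ℝ C) {z w : E}
    (hz : z ∈ intrinsicInterior ℝ C) (hw : w ∈ C) {r : ℝ} (h0 : 0 < r) (h1 : r ≤ 1) :
    w + r • (z - w) ∈ intrinsicInterior ℝ C := by
  obtain ⟨⟨z, hzs⟩, hzi, rfl⟩ := mem_intrinsicInterior.1 hz
  have hws := subset_affineSpan ℝ C hw
  have hmem : ∀ (t : ℝ), ∀ u ∈ affineSpan ℝ C, w + t • (u - w) ∈ affineSpan ℝ C := fun t u hu => by
    have := AffineMap.lineMap_mem t hws hu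
    rwa [AffineMap.lineMap_apply_module', add_comm] at this
  let g : affineSpan ℝ C → affineSpan ℝ C := fun u => ⟨w + r⁻¹ • ((u : E) - w), hmem _ _ u.2⟩
  have hg : Continuous g := by
    refine Continuous.subtype_mk ?_ _
    fun_prop
  have hx : g ⟨w + r • (z - w), hmem r z hzs⟩ = ⟨z, hzs⟩ := by
    ext
    simp [g, smul_smul, inv_mul_cancel₀ h0.ne']
  refine mem_intrinsicInterior.2 ⟨⟨w + r • (z - w), hmem r z hzs⟩, ?_, rfl⟩
  rw [mem_interior_iff_mem_nhds]
  have hnhds := hg.continuousAt.preimage_mem_nhds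
    (by rw [hx]; exact mem_interior_iff_mem_nhds.1 hzi)
  filter_upwards [hnhds] with u hu
  have hu' : w + r⁻¹ • ((u : E) - w) ∈ C := hu
  have := hC hw hu' (sub_nonneg.2 h1) h0.le (by ring)
  rwa [smul_add, smul_smul, mul_inv_cancel₀ h0.ne', one_smul,
    show (1 - r) • w + (r • w + ((u : E) - w)) = u by module] at this

theorem convex_intrinsicInterior {C : Set E} (hC : Convex ℝ C) :
    Convex ℝ (intrinsicInterior ℝ C) := by
  intro x hx y hy a b ha hb hab
  rcases ha.eq_or_lt with rfl | ha
  · rw [zero_add] at hab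
    simpa [hab] using hy
  · have := add_smul_mem_intrinsicInterior hC hx (intrinsicInterior_subset hy) ha (by linarith)
    convert this using 1
    obtain rfl : b = 1 - a := by linarith
    module

variable [FiniteDimensional ℝ E] [FiniteDimensional ℝ E']

/-- A point of a convex set is in the relative interior if and only if every segment of the set
ending in it can be prolonged. -/
theorem mem_intrinsicInterior_iff {C : Set E} (hC : Convex ℝ C) {x : E} :
    x ∈ intrinsicInterior ℝ C ↔ x ∈ C ∧ ∀ y ∈ C, ∃ ε > (0 : ℝ), x + ε • (x - y) ∈ C := by
  refine ⟨fun hx => ⟨intrinsicInterior_subset hx, fun y hy =>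
    exists_add_smul_mem_of_mem_intrinsicInterior hx hy⟩, fun ⟨hx, h⟩ => ?_⟩
  obtain ⟨z, hz⟩ := Set.Nonempty.intrinsicInterior hC ⟨x, hx⟩
  obtain ⟨ε, hε, hw⟩ := h z (intrinsicInterior_subset hz)
  -- With `w = x + ε (x - z)`, solving for `x` gives `x = w + ε/(1+ε) (z - w)`, a point strictly
  -- between `w` and the relative interior point `z`.
  have := add_smul_mem_intrinsicInterior hC hz hw (r := ε / (1 + ε)) (by positivity)
    ((div_le_one (by positivity)).2 (by linarith))
  convert this using 1
  match_scalars <;> field_simp <;> ring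

theorem intrinsicInterior_image_linearMap (f : E →ₗ[ℝ] E') {C : Set E} (hC : Convex ℝ C) :
    intrinsicInterior ℝ (f '' C) = f '' intrinsicInterior ℝ C := by
  ext p
  constructor
  · intro hp
    obtain ⟨hpC, hp⟩ := (mem_intrinsicInterior_iff (hC.linear_image f)).1 hp
    obtain ⟨x, hx⟩ := Set.Nonempty.intrinsicInterior hC (image_nonempty.1 ⟨p, hpC⟩)
    obtain ⟨ε, hε, y, hy, hyp⟩ := hp (f x) (mem_image_of_mem f (intrinsicInterior_subset hx))
    refine ⟨_, add_smul_mem_intrinsicInterior hC hx hy (r := ε / (1 + ε)) (by positivity)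
      ((div_le_one (by positivity)).2 (by linarith)), ?_⟩
    rw [map_add, map_smul, map_sub, hyp]
    match_scalars <;> field_simp <;> ring
  · rintro ⟨x, hx, rfl⟩
    refine (mem_intrinsicInterior_iff (hC.linear_image f)).2
      ⟨mem_image_of_mem f (intrinsicInterior_subset hx), ?_⟩
    rintro _ ⟨y, hy, rfl⟩
    obtain ⟨ε, hε, h⟩ := exists_add_smul_mem_of_mem_intrinsicInterior hx hy
    exact ⟨ε, hε, _, h, by simp⟩

open Filter Topology in
-- By convexity one admissible `ε` makes all smaller ones admissible; in this form finitely many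
-- sets can be handled with a common `ε`.
theorem mem_intrinsicInterior_iff_eventually {C : Set E} (hC : Convex ℝ C) {x : E} :
    x ∈ intrinsicInterior ℝ C ↔
      x ∈ C ∧ ∀ y ∈ C, ∀ᶠ ε in 𝓝[>] (0 : ℝ), x + ε • (x - y) ∈ C := by
  rw [mem_intrinsicInterior_iff hC]
  refine and_congr_right fun hx => forall₂_congr fun y _ => ⟨?_, fun h => ?_⟩
  · rintro ⟨ε, hε, h⟩
    filter_upwards [Ioc_mem_nhdsGT hε] with δ hδ
    have h1 : 0 ≤ δ / ε := (div_pos hδ.1 hε).le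
    have h2 : δ / ε ≤ 1 := (div_le_one hε).2 hδ.2
    convert hC hx h (sub_nonneg.2 h2) h1 (by ring) using 1
    match_scalars <;> field_simp
    ring
  · obtain ⟨ε, h1, h2⟩ := (h.and self_mem_nhdsWithin).exists
    exact ⟨ε, h2, h1⟩

/-- The relative interior of a finite intersection of convex sets whose relative interiors have a
common point. -/
theorem mem_intrinsicInterior_biInter {ι : Type*} {J : Set ι} (hJ : J.Finite) {C : ι → Set E}
    (hC : ∀ i ∈ J, Convex ℝ (C i)) {z : E} (hz : ∀ i ∈ J, z ∈ intrinsicInterior ℝ (C i)) {x : E} :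
    x ∈ intrinsicInterior ℝ (⋂ i ∈ J, C i) ↔ ∀ i ∈ J, x ∈ intrinsicInterior ℝ (C i) := by
  have hconv : Convex ℝ (⋂ i ∈ J, C i) := convex_iInter₂ hC
  constructor
  · intro hx i hi
    obtain ⟨ε, hε, h⟩ := exists_add_smul_mem_of_mem_intrinsicInterior hx
      (mem_iInter₂.2 fun j hj => intrinsicInterior_subset (hz j hj))
    have := add_smul_mem_intrinsicInterior (hC i hi) (hz i hi) (mem_iInter₂.1 h i hi)
      (r := ε / (1 + ε)) (by positivity) ((div_le_one (by positivity)).2 (by linarith))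
    convert this using 1
    match_scalars <;> field_simp <;> ring
  · intro h
    refine (mem_intrinsicInterior_iff_eventually hconv).2
      ⟨mem_iInter₂.2 fun i hi => intrinsicInterior_subset (h i hi), fun y hy => ?_⟩
    have := (Filter.eventually_all_finite hJ).2 fun i hi =>
      ((mem_intrinsicInterior_iff_eventually (hC i hi)).1 (h i hi)).2 y (mem_iInter₂.1 hy i hi)
    filter_upwards [this] with ε hε
    exact mem_iInter₂.2 hε

end RelativeInterior

/-! ### Finitely generated cones: Weyl, Minkowski, separation and support -/

section FinitelyGeneratedCones

theorem exists_between_of_forall_le (L U : Finset ℝ) (h : ∀ l ∈ L, ∀ u ∈ U, l ≤ u) :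
    ∃ r, (∀ l ∈ L, l ≤ r) ∧ ∀ u ∈ U, r ≤ u := by
  rcases L.eq_empty_or_nonempty with rfl | hL
  · rcases U.eq_empty_or_nonempty with rfl | hU
    · exact ⟨0, by simp, by simp⟩
    · exact ⟨U.min' hU, by simp, fun u hu => U.min'_le u hu⟩
  · exact ⟨L.max' hL, fun l hl => L.le_max' l hl, fun u hu => h _ (L.max'_mem hL) u hu⟩

variable {E : Type*} [NormedAddCommGroup E] [NormedSpace ℝ E]

/-- Fourier–Motzkin elimination. -/
theorem exists_finset_dual_add_ray (T : Finset (E →L[ℝ] ℝ)) (v : E) :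
    ∃ T' : Finset (E →L[ℝ] ℝ), ∀ x,
      (∃ r : ℝ, 0 ≤ r ∧ ∀ t ∈ T, 0 ≤ t (x - r • v)) ↔ ∀ t ∈ T', 0 ≤ t x := by
  classical
  -- Keep the functionals that are nonnegative at `v`; for each pair of opposite signs at `v`, add
  -- the positive combination that vanishes at `v`.
  refine ⟨T.filter (fun t => 0 ≤ t v) ∪
    ((T.filter fun t => 0 < t v) ×ˢ (T.filter fun t => t v < 0)).image (fun p => (-p.2 v) • p.1 + (p.1 v) • p.2), fun x => ⟨?_, fun h => ?_⟩⟩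
  · rintro ⟨r, hr, h⟩ t ht
    simp only [Finset.mem_union, Finset.mem_filter, Finset.mem_image, Finset.mem_product,
      Prod.exists] at ht
    simp only [map_sub, map_smul, smul_eq_mul] at h
    rcases ht with ⟨ht, hv⟩ | ⟨t₁, t₂, ⟨⟨h₁, hv₁⟩, h₂, hv₂⟩, rfl⟩
    · have := h t ht
      have := mul_nonneg hr hv
      linarith
    · have e₁ := mul_nonneg (h t₁ h₁) (neg_nonneg.2 hv₂.le)
      have e₂ := mul_nonneg (h t₂ h₂) hv₁.le
      simp only [_root_.add_apply, _root_.smul_apply, smul_eq_mul]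
      linarith
  -- The condition `0 ≤ t (x - r • v)` bounds `r` by `t x / t v`, from below if `t v < 0` and from
  -- above if `t v > 0`. The inserted `0` enforces `0 ≤ r`.
  · obtain ⟨r, hL, hU⟩ := exists_between_of_forall_le
      (insert 0 ((T.filter fun t => t v < 0).image fun t => t x / t v))
      ((T.filter fun t => 0 < t v).image fun t => t x / t v) (by
        intro l hl u hu
        simp only [Finset.mem_image, Finset.mem_insert, Finset.mem_filter] at hl hu
        obtain ⟨t₁, ⟨h₁, hv₁⟩, rfl⟩ := hu
        rcases hl with rfl | ⟨t₂, ⟨h₂, hv₂⟩, rfl⟩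
        · exact div_nonneg (h t₁ (by simp [h₁, hv₁.le])) hv₁.le
        · have := h ((-t₂ v) • t₁ + (t₁ v) • t₂) (Finset.mem_union_right _
            (Finset.mem_image.2 ⟨(t₁, t₂), by simp [h₁, hv₁, h₂, hv₂], rfl⟩))
          simp only [_root_.add_apply, _root_.smul_apply,
            smul_eq_mul] at this
          rw [div_le_iff_of_neg hv₂, div_mul_eq_mul_div, div_le_iff₀ hv₁]
          linarith)
    refine ⟨r, hL 0 (by simp), fun t ht => ?_⟩
    simp only [map_sub, map_smul, smul_eq_mul]
    rcases lt_trichotomy (t v) 0 with hv | hv | hv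
    · have := hL (t x / t v) (by
        simp only [Finset.mem_insert, Finset.mem_image, Finset.mem_filter]
        exact Or.inr ⟨t, ⟨ht, hv⟩, rfl⟩)
      rw [div_le_iff_of_neg hv] at this
      linarith
    · rw [hv, mul_zero, sub_zero]
      exact h t (by simp [ht, hv])
    · have := hU (t x / t v) (by
        simp only [Finset.mem_image, Finset.mem_filter]
        exact ⟨t, ⟨ht, hv⟩, rfl⟩)
      rw [le_div_iff₀ hv] at this
      linarith

variable [FiniteDimensional ℝ E]

theorem exists_finset_dual_bot :
    ∃ T : Finset (E →L[ℝ] ℝ), ∀ x, (x = 0 ↔ ∀ t ∈ T, 0 ≤ t x) := by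
  classical
  let b := Module.finBasis ℝ E
  let f : Fin (Module.finrank ℝ E) → E →L[ℝ] ℝ := fun i =>
    LinearMap.toContinuousLinearMap (b.coord i)
  refine ⟨Finset.univ.image f ∪ Finset.univ.image (-f), fun x => ⟨fun h => by simp [h], fun h => ?_⟩⟩
  refine b.ext_elem fun i => ?_
  have h1 : 0 ≤ f i x := h (f i) (by simp)
  have h2 : 0 ≤ (-f i) x := h _ (Finset.mem_union_right _ (Finset.mem_image.2 ⟨i, by simp, rfl⟩))
  have h3 : f i x = b.repr x i := rfl
  rw [← h3, map_zero, Finsupp.zero_apply]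
  simp only [_root_.neg_apply] at h2
  linarith

/-- Weyl's theorem: finitely generated cones are intersections of finitely many half-spaces. -/
theorem exists_finset_dual_of_fg {K : PointedCone ℝ E} (hK : K.FG) :
    ∃ T : Finset (E →L[ℝ] ℝ), ∀ x, x ∈ K ↔ ∀ t ∈ T, 0 ≤ t x := by
  classical
  obtain ⟨S, rfl⟩ := hK
  induction S using Finset.induction_on with
  | empty =>
    obtain ⟨T, hT⟩ := exists_finset_dual_bot (E := E)
    exact ⟨T, fun x => by rw [← hT]; simp⟩
  | insert v S _ ih =>
    obtain ⟨T, hT⟩ := ih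
    obtain ⟨T', hT'⟩ := exists_finset_dual_add_ray T v
    refine ⟨T', fun x => ?_⟩
    rw [← hT', Finset.coe_insert, Submodule.mem_span_insert]
    constructor
    · rintro ⟨a, z, hz, rfl⟩
      refine ⟨a, a.2, (hT _).1 ?_⟩
      rwa [show a • v + z - (a : ℝ) • v = z by rw [← Nonneg.coe_smul]; abel]
    · rintro ⟨r, hr, h⟩
      exact ⟨(⟨r, hr⟩ : {c : ℝ // 0 ≤ c}), x - r • v, (hT _).2 h, by rw [← Nonneg.coe_smul]; simp⟩

theorem isClosed_of_fg {K : PointedCone ℝ E} (hK : K.FG) : IsClosed (K : Set E) := by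
  obtain ⟨T, hT⟩ := exists_finset_dual_of_fg hK
  have : (K : Set E) = ⋂ t ∈ T, {x | 0 ≤ t x} := by
    ext x
    simp [hT]
  rw [this]
  exact isClosed_biInter fun t _ => isClosed_le continuous_const t.continuous

theorem exists_neg_of_notMem_of_fg {K : PointedCone ℝ E} (hK : K.FG) {x : E} (hx : x ∉ K) :
    ∃ t : E →L[ℝ] ℝ, (∀ y ∈ K, 0 ≤ t y) ∧ t x < 0 := by
  obtain ⟨T, hT⟩ := exists_finset_dual_of_fg hK
  rw [hT] at hx
  push Not at hx
  obtain ⟨t, ht, htx⟩ := hx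
  exact ⟨t, fun y hy => (hT y).1 hy t ht, htx⟩

/-- A point of a finitely generated cone that is not in the relative interior lies in a proper
face. -/
theorem exists_supporting_of_notMem_intrinsicInterior {K : PointedCone ℝ E} (hK : K.FG) {x : E}
    (hx : x ∈ K) (hxi : x ∉ intrinsicInterior ℝ (K : Set E)) :
    ∃ t : E →L[ℝ] ℝ, (∀ y ∈ K, 0 ≤ t y) ∧ t x = 0 ∧ ∃ y ∈ K, 0 < t y := by
  have hconv : Convex ℝ (K : Set E) := (K : ConvexCone ℝ E).convex
  rw [mem_intrinsicInterior_iff hconv] at hxi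
  push Not at hxi
  obtain ⟨y, hy, h⟩ := hxi hx
  -- Since the segment from `y` cannot be prolonged past `x`, `-y` is not in the cone generated by
  -- `K` and `-x`. A functional separating it is nonnegative on `K` and at `-x`, so it vanishes at
  -- `x` and is positive at `y`.
  have hfg : (K ⊔ Submodule.span _ {-x} : PointedCone ℝ E).FG :=
    hK.sup (Submodule.fg_span_singleton _)
  have hmem : -y ∉ (K ⊔ Submodule.span _ {-x} : PointedCone ℝ E) := by
    intro hmem
    obtain ⟨z, hz, w, hw, hzw⟩ := Submodule.mem_sup.1 hmem
    obtain ⟨⟨a, ha⟩, rfl⟩ := Submodule.mem_span_singleton.1 hw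
    refine h (1 / (a + 1)) (by positivity) ?_
    have := K.smul_mem (r := 1 / (a + 1)) (by positivity) (K.add_mem (K.add_mem hz hx) hx)
    have hz' : z = a • x - y := by
      have : (⟨a, ha⟩ : {c : ℝ // 0 ≤ c}) • -x = a • -x := rfl
      rw [sub_eq_add_neg, ← hzw, this]
      module
    rw [hz'] at this
    rw [SetLike.mem_coe]
    convert this using 1
    match_scalars <;> field_simp
  obtain ⟨t, ht, hty⟩ := exists_neg_of_notMem_of_fg hfg hmem
  have h1 : ∀ y ∈ K, 0 ≤ t y := fun y hy => ht y (Submodule.mem_sup_left hy)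
  have h2 : 0 ≤ t (-x) := ht _ (Submodule.mem_sup_right (Submodule.mem_span_singleton_self _))
  rw [map_neg] at h2 hty
  exact ⟨t, h1, le_antisymm (by linarith) (h1 x hx), y, hy, by linarith⟩

theorem exists_eval_eq (φ : (E →L[ℝ] ℝ) →L[ℝ] ℝ) : ∃ x : E, ∀ l : E →L[ℝ] ℝ, φ l = l x := by
  let e : Module.Dual ℝ E ≃ₗ[ℝ] (E →L[ℝ] ℝ) := LinearMap.toContinuousLinearMap
  refine ⟨(Module.evalEquiv ℝ E).symm (φ.toLinearMap ∘ₗ e.toLinearMap), fun l => ?_⟩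
  have h := (Module.evalEquiv ℝ E).apply_symm_apply (φ.toLinearMap ∘ₗ e.toLinearMap)
  exact (LinearMap.congr_fun h (e.symm l)).symm

/-- Minkowski's theorem: the polar cone of a finite set is finitely generated. -/
theorem exists_fg_of_finset_dual {S : Set E} (hS : S.Finite) :
    ∃ K : PointedCone ℝ (E →L[ℝ] ℝ), K.FG ∧ ∀ l, l ∈ K ↔ ∀ x ∈ S, l x ≤ 0 := by
  classical
  -- Weyl's theorem gives inequalities `T` for the cone over `S`; the negatives of `T` generate the
  -- polar. If `l` in the polar were outside their cone, a separating point `x` would have `-x` in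
  -- the cone over `S` and `l x < 0`, contradicting `l (-x) ≤ 0`.
  obtain ⟨T, hT⟩ := exists_finset_dual_of_fg (K := PointedCone.hull ℝ S) (Submodule.fg_span hS)
  have hfg : (PointedCone.hull ℝ ((T.image Neg.neg : Finset _) : Set (E →L[ℝ] ℝ))).FG :=
    Submodule.fg_span (Finset.finite_toSet _)
  refine ⟨_, hfg, fun l => ⟨fun hl x hx => ?_, fun h => ?_⟩⟩
  · induction hl using Submodule.span_induction with
    | mem l hl =>
      obtain ⟨t, ht, rfl⟩ := Finset.mem_image.1 (Finset.mem_coe.1 hl)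
      have := (hT x).1 (Submodule.subset_span hx) t ht
      simpa using this
    | zero => simp
    | add l m _ _ hl hm => simpa using add_nonpos hl hm
    | smul a l _ hl =>
      rw [← Nonneg.coe_smul]
      exact mul_nonpos_of_nonneg_of_nonpos a.2 hl
  · by_contra hl
    obtain ⟨φ, hφ, hlt⟩ := exists_neg_of_notMem_of_fg hfg hl
    obtain ⟨x, hx⟩ := exists_eval_eq φ
    have hmem : -x ∈ PointedCone.hull ℝ S := by
      refine (hT _).2 fun t ht => ?_
      have := hφ (-t) (Submodule.subset_span (Finset.mem_coe.2 (Finset.mem_image_of_mem _ ht)))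
      rw [hx] at this
      simpa using this
    have hle : ∀ y ∈ PointedCone.hull ℝ S, l y ≤ 0 := fun y hy => by
      induction hy using Submodule.span_induction with
      | mem y hy => exact h y hy
      | zero => simp
      | add y z _ _ hy hz => rw [map_add]; exact add_nonpos hy hz
      | smul a y _ hy =>
        rw [← Nonneg.coe_smul, map_smul]
        exact mul_nonpos_of_nonneg_of_nonpos a.2 hy
    have := hle _ hmem
    rw [map_neg] at this
    rw [hx] at hlt
    linarith

theorem exists_eval_neg_of_notMem_of_fg {K : PointedCone ℝ (E →L[ℝ] ℝ)} (hK : K.FG)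
    {C : Set (E →L[ℝ] ℝ)} (hKC : (K : Set (E →L[ℝ] ℝ)) = C) {l : E →L[ℝ] ℝ} (hl : l ∉ C) :
    ∃ x : E, (∀ m ∈ C, 0 ≤ m x) ∧ l x < 0 := by
  subst hKC
  obtain ⟨t, ht, htl⟩ := exists_neg_of_notMem_of_fg hK hl
  obtain ⟨x, hx⟩ := exists_eval_eq t
  exact ⟨x, fun m hm => hx m ▸ ht m hm, hx l ▸ htl⟩

theorem exists_eval_supporting_of_notMem_intrinsicInterior {K : PointedCone ℝ (E →L[ℝ] ℝ)}
    (hK : K.FG) {C : Set (E →L[ℝ] ℝ)} (hKC : (K : Set (E →L[ℝ] ℝ)) = C) {l : E →L[ℝ] ℝ}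
    (hl : l ∈ C) (hli : l ∉ intrinsicInterior ℝ C) :
    ∃ x : E, (∀ m ∈ C, 0 ≤ m x) ∧ l x = 0 ∧ ∃ m ∈ C, 0 < m x := by
  subst hKC
  obtain ⟨t, ht, htl, m, hm, hpos⟩ := exists_supporting_of_notMem_intrinsicInterior hK hl hli
  obtain ⟨x, hx⟩ := exists_eval_eq t
  exact ⟨x, fun m hm => hx m ▸ ht m hm, hx l ▸ htl, m, hm, hx m ▸ hpos⟩

end FinitelyGeneratedCones

/-! ### The symmetric model of the two projections -/

/-- Two finite families of closed convex sets, indexed by the same set `I` with a relation `le`,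
such that the products of the relative interiors of `A i` and `B i` partition `X × Y`. -/
structure FacePairing (ι E E' : Type*) [NormedAddCommGroup E] [NormedSpace ℝ E]
    [NormedAddCommGroup E'] [NormedSpace ℝ E'] where
  I : Set ι
  le : ι → ι → Prop
  A : ι → Set E
  B : ι → Set E'
  X : Set E
  Y : Set E'
  F : E → E' → ι
  finite : I.Finite
  antisymm : ∀ i ∈ I, ∀ j ∈ I, le i j → le j i → i = j
  convexA : ∀ i ∈ I, Convex ℝ (A i)
  closedA : ∀ i ∈ I, IsClosed (A i)
  nonemptyA : ∀ i ∈ I, (A i).Nonempty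
  subA : ∀ i ∈ I, A i ⊆ X
  convexB : ∀ i ∈ I, Convex ℝ (B i)
  closedB : ∀ i ∈ I, IsClosed (B i)
  nonemptyB : ∀ i ∈ I, (B i).Nonempty
  subB : ∀ i ∈ I, B i ⊆ Y
  nonemptyX : X.Nonempty
  nonemptyY : Y.Nonempty
  monoA : ∀ i ∈ I, ∀ j ∈ I, le i j → A i ⊆ A j
  antiB : ∀ i ∈ I, ∀ j ∈ I, le i j → B j ⊆ B i
  F_mem : ∀ q ∈ X, ∀ ψ ∈ Y, F q ψ ∈ I
  F_iff : ∀ q ∈ X, ∀ ψ ∈ Y, ∀ i ∈ I,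
    (F q ψ = i ↔ q ∈ intrinsicInterior ℝ (A i) ∧ ψ ∈ intrinsicInterior ℝ (B i))
  -- Letting `q` reach the boundary of `A i` can only lower the index; letting `ψ` reach the
  -- boundary of `B i` can only raise it. The two axioms are mirror images under `swap`.
  F_le : ∀ i ∈ I, ∀ q ∈ A i, ∀ ψ ∈ intrinsicInterior ℝ (B i), le (F q ψ) i
  le_F : ∀ i ∈ I, ∀ q ∈ intrinsicInterior ℝ (A i), ∀ ψ ∈ B i, le i (F q ψ)

namespace FacePairing

variable {ι E E' : Type*} [NormedAddCommGroup E] [NormedSpace ℝ E]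
    [NormedAddCommGroup E'] [NormedSpace ℝ E'] (D : FacePairing ι E E')

/-- Exchange of the two families. -/
def swap : FacePairing ι E' E where
  I := D.I
  le i j := D.le j i
  A := D.B
  B := D.A
  X := D.Y
  Y := D.X
  F ψ q := D.F q ψ
  finite := D.finite
  antisymm i hi j hj h h' := D.antisymm i hi j hj h' h
  convexA := D.convexB
  closedA := D.closedB
  nonemptyA := D.nonemptyB
  subA := D.subB
  convexB := D.convexA
  closedB := D.closedA
  nonemptyB := D.nonemptyA
  subB := D.subA
  nonemptyX := D.nonemptyY
  nonemptyY := D.nonemptyX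
  monoA i hi j hj h := D.antiB j hj i hi h
  antiB i hi j hj h := D.monoA j hj i hi h
  F_mem ψ hψ q hq := D.F_mem q hq ψ hψ
  F_iff ψ hψ q hq i hi := (D.F_iff q hq ψ hψ i hi).trans and_comm
  F_le i hi ψ hψ q hq := D.le_F i hi q hq ψ hψ
  le_F i hi ψ hψ q hq := D.F_le i hi q hq ψ hψ

/-- The cell of a point of `X`. -/
def cell (q : E) : Set E := {p | p ∈ D.X ∧ ∀ i ∈ D.I, q ∈ D.A i → p ∈ D.A i}

/-- Local coherence of a map from `X` to `Y`. -/
def Coherent (Ψ : E → E') : Prop :=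
  MapsTo Ψ D.X D.Y ∧ ∀ q ∈ D.X, ∀ p ∈ D.cell q, D.F p (Ψ q) = D.F p (Ψ p)

variable {D} {q p : E} {ψ φ : E'} {i j : ι}

theorem mem_riA (hq : q ∈ D.X) (hψ : ψ ∈ D.Y) : q ∈ intrinsicInterior ℝ (D.A (D.F q ψ)) :=
  ((D.F_iff q hq ψ hψ _ (D.F_mem q hq ψ hψ)).1 rfl).1

theorem mem_riB (hq : q ∈ D.X) (hψ : ψ ∈ D.Y) : ψ ∈ intrinsicInterior ℝ (D.B (D.F q ψ)) :=
  D.swap.mem_riA hψ hq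

theorem mem_A (hq : q ∈ D.X) (hψ : ψ ∈ D.Y) : q ∈ D.A (D.F q ψ) :=
  intrinsicInterior_subset (mem_riA hq hψ)

theorem mem_X_of_mem_riA (hi : i ∈ D.I) (hq : q ∈ intrinsicInterior ℝ (D.A i)) : q ∈ D.X :=
  D.subA i hi (intrinsicInterior_subset hq)

theorem mem_Y_of_mem_riB (hi : i ∈ D.I) (hψ : ψ ∈ intrinsicInterior ℝ (D.B i)) : ψ ∈ D.Y :=
  D.subB i hi (intrinsicInterior_subset hψ)

theorem F_eq (hi : i ∈ D.I) (hq : q ∈ intrinsicInterior ℝ (D.A i))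
    (hψ : ψ ∈ intrinsicInterior ℝ (D.B i)) : D.F q ψ = i :=
  (D.F_iff q (mem_X_of_mem_riA hi hq) ψ (mem_Y_of_mem_riB hi hψ) i hi).2 ⟨hq, hψ⟩

theorem mem_cell_self (hq : q ∈ D.X) : q ∈ D.cell q := ⟨hq, fun _ _ h => h⟩

theorem cell_subset (h : p ∈ D.cell q) : D.cell p ⊆ D.cell q :=
  fun _ hr => ⟨hr.1, fun i hi hq => hr.2 i hi (h.2 i hi hq)⟩

section

variable [FiniteDimensional ℝ E']

theorem riB_nonempty (hi : i ∈ D.I) : (intrinsicInterior ℝ (D.B i)).Nonempty :=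
  Set.Nonempty.intrinsicInterior (D.convexB i hi) (D.nonemptyB i hi)

/-- If `q` is only a boundary point of `A i`, choose `ψ ∈ relint (B i)`: then `F q ψ` is below `i`
and has `q` in the relative interior of its set, so it gives the stronger condition. -/
theorem mem_cell_iff (hq : q ∈ D.X) :
    p ∈ D.cell q ↔ p ∈ D.X ∧ ∀ i ∈ D.I, q ∈ intrinsicInterior ℝ (D.A i) → p ∈ D.A i := by
  refine ⟨fun h => ⟨h.1, fun i hi hqi => h.2 i hi (intrinsicInterior_subset hqi)⟩,
    fun ⟨hp, h⟩ => ⟨hp, fun i hi hqi => ?_⟩⟩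
  obtain ⟨ψ, hψ⟩ := riB_nonempty hi
  have hψY := mem_Y_of_mem_riB hi hψ
  exact D.monoA _ (D.F_mem q hq ψ hψY) i hi (D.F_le i hi q hqi ψ hψ)
    (h _ (D.F_mem q hq ψ hψY) (mem_riA hq hψY))

/-- Turns inclusion of cells into pointwise comparison of indices, the form taken by the orders on
virtual cells and virtual cones. -/
theorem mem_cell_iff_le (hq : q ∈ D.X) :
    p ∈ D.cell q ↔ p ∈ D.X ∧ ∀ ψ ∈ D.Y, D.le (D.F p ψ) (D.F q ψ) := by
  refine ⟨fun h => ⟨h.1, fun ψ hψ => D.F_le _ (D.F_mem q hq ψ hψ) p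
    (h.2 _ (D.F_mem q hq ψ hψ) (mem_A hq hψ)) ψ (mem_riB hq hψ)⟩, fun ⟨hp, h⟩ => ?_⟩
  refine (mem_cell_iff hq).2 ⟨hp, fun i hi hqi => ?_⟩
  obtain ⟨ψ, hψ⟩ := riB_nonempty hi
  have hψY := mem_Y_of_mem_riB hi hψ
  have := h ψ hψY
  rw [F_eq hi hqi hψ] at this
  exact D.monoA _ (D.F_mem p hp ψ hψY) i hi this (mem_A hp hψY)

/-- All sets in this intersection have `q` as a relative interior point, as needed to compute the
relative interior of the cell. -/
theorem cell_eq_biInter (hq : q ∈ D.X) :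
    D.cell q = ⋂ i ∈ {i | i ∈ D.I ∧ q ∈ intrinsicInterior ℝ (D.A i)}, D.A i := by
  ext p
  rw [mem_cell_iff hq]
  simp only [mem_ofPred_eq, mem_iInter, and_imp, and_iff_right_iff_imp]
  intro h
  obtain ⟨ψ, hψ⟩ := D.nonemptyY
  exact D.subA _ (D.F_mem q hq ψ hψ) (h _ (D.F_mem q hq ψ hψ) (mem_riA hq hψ))

variable [FiniteDimensional ℝ E]

theorem mem_ri_cell_iff (hq : q ∈ D.X) :
    p ∈ intrinsicInterior ℝ (D.cell q) ↔ p ∈ D.X ∧ ∀ ψ ∈ D.Y, D.F p ψ = D.F q ψ := by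
  rw [cell_eq_biInter hq, mem_intrinsicInterior_biInter (z := q) (D.finite.subset fun i hi => hi.1)
    (fun i hi => D.convexA i hi.1) (fun i hi => hi.2)]
  constructor
  · intro h
    have key : ∀ ψ ∈ D.Y, p ∈ intrinsicInterior ℝ (D.A (D.F q ψ)) := fun ψ hψ =>
      h _ ⟨D.F_mem q hq ψ hψ, mem_riA hq hψ⟩
    obtain ⟨ψ, hψ⟩ := D.nonemptyY
    exact ⟨mem_X_of_mem_riA (D.F_mem q hq ψ hψ) (key ψ hψ),
      fun ψ hψ => F_eq (D.F_mem q hq ψ hψ) (key ψ hψ) (mem_riB hq hψ)⟩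
  · rintro ⟨hp, h⟩ i ⟨hi, hqi⟩
    obtain ⟨ψ, hψ⟩ := riB_nonempty hi
    have hψY := mem_Y_of_mem_riB hi hψ
    have := mem_riA hp hψY
    rwa [h ψ hψY, F_eq hi hqi hψ] at this

theorem mem_ri_cell_self (hq : q ∈ D.X) : q ∈ intrinsicInterior ℝ (D.cell q) :=
  (mem_ri_cell_iff hq).2 ⟨hq, fun _ _ => rfl⟩

theorem cell_eq_of_mem_ri (hq : q ∈ D.X) (hp : p ∈ intrinsicInterior ℝ (D.cell q)) :
    D.cell p = D.cell q := by
  obtain ⟨hpX, h⟩ := (mem_ri_cell_iff hq).1 hp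
  ext r
  rw [mem_cell_iff_le hq, mem_cell_iff_le hpX]
  refine and_congr_right fun _ => forall₂_congr fun ψ hψ => by rw [h ψ hψ]

end

/-- Since `F p ψ` lies below `i`, its `B` contains `B i` and hence `φ`, so `le_F` bounds `F p ψ` by
`F p φ`. The roles of `ψ` and `φ` are symmetric. -/
theorem F_eq_F_of_mem_A (hi : i ∈ D.I) (hp : p ∈ D.A i) (hψ : ψ ∈ intrinsicInterior ℝ (D.B i))
    (hφ : φ ∈ intrinsicInterior ℝ (D.B i)) : D.F p ψ = D.F p φ := by
  have hpX := D.subA i hi hp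
  have key : ∀ ψ φ, ψ ∈ intrinsicInterior ℝ (D.B i) → φ ∈ intrinsicInterior ℝ (D.B i) →
      D.le (D.F p ψ) (D.F p φ) := fun ψ φ hψ hφ => by
    have hψY := mem_Y_of_mem_riB hi hψ
    have hmem := D.F_mem p hpX ψ hψY
    exact D.le_F _ hmem p (mem_riA hpX hψY) φ
      (D.antiB _ hmem i hi (D.F_le i hi p hp ψ hψ) (intrinsicInterior_subset hφ))
  exact D.antisymm _ (D.F_mem p hpX ψ (mem_Y_of_mem_riB hi hψ)) _
    (D.F_mem p hpX φ (mem_Y_of_mem_riB hi hφ)) (key ψ φ hψ hφ) (key φ ψ hφ hψ)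

theorem coherent_const (hψ : ψ ∈ D.Y) : D.Coherent fun _ => ψ :=
  ⟨fun _ _ => hψ, fun _ _ _ _ => rfl⟩

/-- Links `Coherent` to the relative interior condition: the index over `p ∈ [q]` is the same for
all values in the relative interior containing `Ψ q`, so testing the single value `Ψ q` suffices. -/
theorem coherent_iff {Ψ : E → E'} (hΨ : MapsTo Ψ D.X D.Y) :
    D.Coherent Ψ ↔ ∀ q ∈ D.X, ∀ p ∈ D.cell q,
      intrinsicInterior ℝ (D.B (D.F q (Ψ q))) ⊆ intrinsicInterior ℝ (D.B (D.F p (Ψ p))) := by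
  refine ⟨fun h q hq p hp φ hφ => ?_, fun h => ⟨hΨ, fun q hq p hp => ?_⟩⟩
  · have hi := D.F_mem q hq _ (hΨ hq)
    have := F_eq_F_of_mem_A hi (hp.2 _ hi (mem_A hq (hΨ hq))) (mem_riB hq (hΨ hq)) hφ
    rw [← h.2 q hq p hp, this]
    exact mem_riB hp.1 (mem_Y_of_mem_riB hi hφ)
  · exact F_eq (D.F_mem p hp.1 _ (hΨ hp.1)) (mem_riA hp.1 (hΨ hp.1))
      (h q hq p hp (mem_riB hq (hΨ hq)))

open Filter Topology in
-- The finitely many closed sets `A i` that miss `p` also miss a neighbourhood of `p`.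
theorem eventually_mem_cell (hp : p ∈ D.X) : ∀ᶠ r in 𝓝 p, p ∈ D.cell r := by
  have : ∀ᶠ r in 𝓝 p, ∀ i ∈ D.I, r ∈ D.A i → p ∈ D.A i := by
    refine (eventually_all_finite D.finite).2 fun i hi => ?_
    by_cases h : p ∈ D.A i
    · exact Eventually.of_forall fun _ _ => h
    · filter_upwards [(D.closedA i hi).isOpen_compl.mem_nhds h] with r hr hr'
      exact absurd hr' hr
  filter_upwards [this] with r hr
  exact ⟨hp, hr⟩

section

variable {Ψ : E → E'}

open Filter Topology in
/-- A locally coherent family is constant on the relative interior of each of its members. -/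
theorem Coherent.F_eq_of_mem_ri (h : D.Coherent Ψ) (hq : q ∈ D.X)
    (hp : p ∈ intrinsicInterior ℝ (D.A (D.F q (Ψ q)))) : D.F p (Ψ p) = D.F q (Ψ q) := by
  have hi := D.F_mem q hq _ (h.1 hq)
  set i := D.F q (Ψ q) with hiq
  have hpre : IsPreconnected (intrinsicInterior ℝ (D.A i)) :=
    (convex_intrinsicInterior (D.convexA i hi)).isPreconnected
  have hX : ∀ r ∈ intrinsicInterior ℝ (D.A i), r ∈ D.X := fun r hr => mem_X_of_mem_riA hi hr
  -- The property `F x (Ψ x) = i` is locally constant on the connected set `relint (A i)`. For `r`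
  -- near `x`, coherence replaces `Ψ x` by `Ψ r` over `x`, and the property at either point then
  -- says `Ψ r ∈ relint (B i)`.
  refine (hpre.induction₂ (fun x y => D.F x (Ψ x) = i ↔ D.F y (Ψ y) = i) (fun x hx => ?_)
    (fun x y z _ _ _ h₁ h₂ => h₁.trans h₂) (fun x y _ _ h => h.symm) (mem_riA hq (h.1 hq)) hp).1
    hiq.symm
  filter_upwards [nhdsWithin_le_nhds (eventually_mem_cell (hX x hx)), self_mem_nhdsWithin]
    with r hr hri
  have hrX := hX r hri
  have hxX := hX x hx
  rw [← h.2 r hrX x hr, D.F_iff x hxX _ (h.1 hrX) i hi, D.F_iff r hrX _ (h.1 hrX) i hi]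
  simp [hx, hri]

open Filter Topology in
-- Move from `p` slightly towards `q`: the point reached is in the relative interior, where the
-- index is constant, and is close enough to `p` for its cell to contain `p`.
theorem Coherent.exists_mem_cell (h : D.Coherent Ψ) (hq : q ∈ D.X)
    (hp : p ∈ D.A (D.F q (Ψ q))) : ∃ r ∈ D.X, D.F r (Ψ r) = D.F q (Ψ q) ∧ p ∈ D.cell r := by
  have hi := D.F_mem q hq _ (h.1 hq)
  have hpX := D.subA _ hi hp
  have hlim : Tendsto (fun t : ℝ => p + t • (q - p)) (𝓝[>] 0) (𝓝 p) := by
    have : Continuous fun t : ℝ => p + t • (q - p) := by fun_prop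
    simpa using (this.tendsto 0).mono_left nhdsWithin_le_nhds
  obtain ⟨t, ht, ht'⟩ := ((hlim.eventually (eventually_mem_cell hpX)).and
    (Ioc_mem_nhdsGT one_pos)).exists
  have hr := add_smul_mem_intrinsicInterior (D.convexA _ hi) (mem_riA hq (h.1 hq)) hp ht'.1 ht'.2
  exact ⟨_, mem_X_of_mem_riA hi hr, h.F_eq_of_mem_ri hq hr, ht⟩

/-- The value of `Ψ` at a nearby `r` with `p ∈ [r]` works. On each member of the family, a coherent
map can thus be treated locally as a constant one. -/
theorem Coherent.exists_common (h : D.Coherent Ψ) (hq : q ∈ D.X) (hp : p ∈ D.A (D.F q (Ψ q))) :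
    ∃ ψ ∈ D.Y, ψ ∈ intrinsicInterior ℝ (D.B (D.F q (Ψ q))) ∧
      ψ ∈ intrinsicInterior ℝ (D.B (D.F p (Ψ p))) := by
  obtain ⟨r, hr, hrq, hpr⟩ := h.exists_mem_cell hq hp
  refine ⟨Ψ r, h.1 hr, hrq ▸ mem_riB hr (h.1 hr), ?_⟩
  rw [← h.2 r hr p hpr]
  exact mem_riB hpr.1 (h.1 hr)

theorem Coherent.le (h : D.Coherent Ψ) (hq : q ∈ D.X) (hp : p ∈ D.A (D.F q (Ψ q))) :
    D.le (D.F p (Ψ p)) (D.F q (Ψ q)) := by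
  have hi := D.F_mem q hq _ (h.1 hq)
  obtain ⟨ψ, hψ, h₁, h₂⟩ := h.exists_common hq hp
  have hpX := D.subA _ hi hp
  have := D.F_le _ hi p hp ψ h₁
  rwa [F_eq (D.F_mem p hpX _ (h.1 hpX)) (mem_riA hpX (h.1 hpX)) h₂] at this

end

variable (D) in
/-- The members of the second family attached to the points of `X`. -/
def family (Ψ : E → E') : Set ι := {i | ∃ q ∈ D.X, i = D.F q (Ψ q)}

theorem family_congr {Ψ Φ : E → E'} (h : ∀ q ∈ D.X, D.F q (Φ q) = D.F q (Ψ q)) :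
    D.family Φ = D.family Ψ := by
  ext i
  exact exists_congr fun q => and_congr_right fun hq => by rw [h q hq]

theorem family_subset {Ψ : E → E'} (h : D.Coherent Ψ) : D.family Ψ ⊆ D.I := by
  rintro _ ⟨q, hq, rfl⟩
  exact D.F_mem q hq _ (h.1 hq)

theorem Coherent.eq_F {Ψ : E → E'} (h : D.Coherent Ψ) (hi : i ∈ D.family Ψ)
    (hq : q ∈ intrinsicInterior ℝ (D.A i)) : i = D.F q (Ψ q) := by
  obtain ⟨p, hp, rfl⟩ := hi
  exact (h.F_eq_of_mem_ri hp hq).symm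

/-- Makes the orders on virtual cones and virtual cells, defined through chosen maps, independent of
the choice. -/
theorem Coherent.F_eq_of_family_eq {Ψ Φ : E → E'} (hΨ : D.Coherent Ψ) (hΦ : D.Coherent Φ)
    (h : D.family Ψ = D.family Φ) (hq : q ∈ D.X) : D.F q (Ψ q) = D.F q (Φ q) :=
  hΦ.eq_F (h ▸ ⟨q, hq, rfl⟩) (mem_riA hq (hΨ.1 hq))

end FacePairing

/-! ### Faces and normal cones of a polytope -/

section Faces

variable {V : Type*} [NormedAddCommGroup V] [NormedSpace ℝ V] {P F G : Set V} {x v : V}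
  {l : V →L[ℝ] ℝ}

theorem IsPolytope.convex (hP : IsPolytope P) : Convex ℝ P := by
  obtain ⟨S, _, _, rfl⟩ := hP
  exact convex_convexHull ℝ S

theorem IsPolytope.isCompact (hP : IsPolytope P) : IsCompact P := by
  obtain ⟨S, hS, _, rfl⟩ := hP
  exact Set.Finite.isCompact_convexHull ℝ hS

theorem IsPolytope.nonempty (hP : IsPolytope P) : P.Nonempty := by
  obtain ⟨S, _, hS, rfl⟩ := hP
  exact hS.convexHull

theorem mem_toExposed : x ∈ l.toExposed P ↔ x ∈ P ∧ ∀ y ∈ P, l y ≤ l x := Iff.rfl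

theorem IsFace.subset (hF : IsFace P F) : F ⊆ P := by
  obtain ⟨_, l, rfl⟩ := hF
  exact fun x hx => hx.1

theorem IsFace.convex (hP : Convex ℝ P) (hF : IsFace P F) : Convex ℝ F := by
  obtain ⟨_, l, rfl⟩ := hF
  exact ContinuousLinearMap.toExposed.isExposed.convex hP

theorem isFace_self (hP : P.Nonempty) : IsFace P P :=
  ⟨hP, 0, by ext x; simp [mem_toExposed]⟩

theorem isFace_toExposed (hx : x ∈ l.toExposed P) : IsFace P (l.toExposed P) := ⟨⟨x, hx⟩, l, rfl⟩

/-- Once some point maximises both functionals, their sum is maximal exactly where both are. -/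
theorem IsFace.inter (hF : IsFace P F) (hG : IsFace P G) (h : (F ∩ G).Nonempty) :
    IsFace P (F ∩ G) := by
  obtain ⟨_, l, rfl⟩ := hF
  obtain ⟨_, m, rfl⟩ := hG
  obtain ⟨z, hz, hz'⟩ := h
  refine ⟨⟨z, hz, hz'⟩, l + m, ?_⟩
  ext x
  simp only [mem_inter_iff, mem_toExposed, add_apply]
  constructor
  · rintro ⟨⟨hx, h₁⟩, -, h₂⟩
    exact ⟨hx, fun y hy => add_le_add (h₁ y hy) (h₂ y hy)⟩
  · rintro ⟨hx, h⟩
    have e := h z hz.1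
    have e₁ := hz.2 x hx
    have e₂ := hz'.2 x hx
    exact ⟨⟨hx, fun y hy => (hz.2 y hy).trans (by linarith)⟩,
      hx, fun y hy => (hz'.2 y hy).trans (by linarith)⟩

theorem convex_normalCone : Convex ℝ (normalCone P F) := by
  intro l hl m hm a b ha hb hab x hx
  refine ⟨(hl hx).1, fun y hy => ?_⟩
  have h₁ := mul_le_mul_of_nonneg_left ((hl hx).2 y hy) ha
  have h₂ := mul_le_mul_of_nonneg_left ((hm hx).2 y hy) hb
  simp only [add_apply, smul_apply, smul_eq_mul]
  linarith

theorem normalCone_anti (h : F ⊆ G) : normalCone P G ⊆ normalCone P F := fun _ hl => h.trans hl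

theorem IsFace.subset_of_normalCone_subset (hG : IsFace P G)
    (h : normalCone P G ⊆ normalCone P F) : F ⊆ G := by
  obtain ⟨_, l, rfl⟩ := hG
  exact h (subset_rfl : l.toExposed P ⊆ l.toExposed P)

theorem IsFace.normalCone_subset_iff (hG : IsFace P G) :
    normalCone P G ⊆ normalCone P F ↔ F ⊆ G :=
  ⟨hG.subset_of_normalCone_subset, normalCone_anti⟩

theorem injOn_normalCone : InjOn (normalCone P) (faces P) := fun _ hF _ hG h =>
  Subset.antisymm (hG.subset_of_normalCone_subset h.ge) (hF.subset_of_normalCone_subset h.le)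

theorem IsFace.subset_of_mem_ri (hG : IsFace P G) (hF : F ⊆ P) (hx : x ∈ intrinsicInterior ℝ F)
    (hxG : x ∈ G) : F ⊆ G := by
  obtain ⟨_, m, rfl⟩ := hG
  intro y hy
  obtain ⟨ε, hε, hmem⟩ := exists_add_smul_mem_of_mem_intrinsicInterior hx hy
  have := hxG.2 _ (hF hmem)
  simp only [map_add, map_smul, map_sub, smul_eq_mul] at this
  have h' : m x ≤ m y := by nlinarith
  exact ⟨hF hy, fun z hz => (hxG.2 z hz).trans h'⟩

/-- By Krein–Milman a face is determined by its extreme points, which form a subset of the finite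
generating set. -/
theorem finite_faces [FiniteDimensional ℝ V] (hP : IsPolytope P) : (faces P).Finite := by
  have hc := hP.isCompact
  have hconv := hP.convex
  obtain ⟨S, hS, _, rfl⟩ := hP
  have hmaps : MapsTo (fun F => F.extremePoints ℝ) (faces (convexHull ℝ S)) (𝒫 S) := by
    rintro _ ⟨_, l, rfl⟩
    have hexp := ContinuousLinearMap.toExposed.isExposed (l := l) (A := convexHull ℝ S)
    exact (hexp.isExtreme.extremePoints_subset_extremePoints).trans extremePoints_convexHull_subset
  refine Finite.of_finite_image (hS.powerset.subset hmaps.image_subset) ?_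
  have key : ∀ F ∈ faces (convexHull ℝ S), closure (convexHull ℝ (F.extremePoints ℝ)) = F := by
    rintro _ ⟨_, l, rfl⟩
    have hexp := ContinuousLinearMap.toExposed.isExposed (l := l) (A := convexHull ℝ S)
    exact closure_convexHull_extremePoints (hexp.isCompact hc) (hexp.convex hconv)
  intro F hF G hG h
  rw [← key F hF, ← key G hG]
  simp only at h
  rw [h]

/-- The intersection of all faces containing a nonempty subset of a polytope is a face. -/
theorem isFace_sInter [FiniteDimensional ℝ V] (hP : IsPolytope P) {X : Set V} (hX : X.Nonempty)
    (hXP : X ⊆ P) : IsFace P (⋂₀ {F | F ∈ faces P ∧ X ⊆ F}) := by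
  have : ∀ 𝒢 ⊆ {F | F ∈ faces P ∧ X ⊆ F}, 𝒢.Finite → IsFace P (P ∩ ⋂₀ 𝒢) := by
    intro 𝒢 h𝒢 hfin
    induction 𝒢, hfin using Set.Finite.induction_on with
    | empty => simpa using isFace_self hP.nonempty
    | @insert F 𝒢 _ _ ih =>
      rw [insert_subset_iff] at h𝒢
      have := h𝒢.1.1.inter (ih h𝒢.2) (hX.mono (subset_inter h𝒢.1.2
        (subset_inter hXP (subset_sInter fun G hG => (h𝒢.2 hG).2))))
      rwa [inter_left_comm, ← sInter_insert] at this
  have h := this _ subset_rfl ((finite_faces hP).subset fun F hF => hF.1)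
  rwa [inter_eq_self_of_subset_right] at h
  exact sInter_subset_of_mem ⟨isFace_self hP.nonempty, hXP⟩

/-- A polytope contains a segment from `x` in every direction of its tangent cone at `x`. -/
theorem exists_add_smul_mem_polytope [FiniteDimensional ℝ V] (hP : IsPolytope P) (hx : x ∈ P)
    (hv : ∀ l : V →L[ℝ] ℝ, x ∈ l.toExposed P → l v ≤ 0) : ∃ ε > (0 : ℝ), x + ε • v ∈ P := by
  have hconv := hP.convex
  obtain ⟨S, hS, _, rfl⟩ := hP
  have hfg : (PointedCone.hull ℝ ((fun s => s - x) '' S)).FG := Submodule.fg_span (hS.image _)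
  -- If `t` separated `v` from the cone of the vectors `s - x`, then `-t` would be maximal at `x`
  -- and positive at `v`. Induction over the cone then produces the segment.
  have hmem : v ∈ PointedCone.hull ℝ ((fun s => s - x) '' S) := by
    by_contra h
    obtain ⟨t, ht, htv⟩ := exists_neg_of_notMem_of_fg hfg h
    have hsub : convexHull ℝ S ⊆ {y | t x ≤ t y} := by
      refine convexHull_min (fun s hs => ?_) (convex_halfSpace_ge t.isLinear _)
      have := ht _ (Submodule.subset_span (mem_image_of_mem _ hs))
      simpa using this
    have := hv (-t) ⟨hx, fun y hy => by simpa using hsub hy⟩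
    simp only [neg_apply] at this
    linarith
  clear hv
  induction hmem using Submodule.span_induction with
  | mem v hv =>
    obtain ⟨s, hs, rfl⟩ := hv
    exact ⟨1, one_pos, by simpa using subset_convexHull ℝ S hs⟩
  | zero => exact ⟨1, one_pos, by simpa using hx⟩
  | add v w _ _ hv hw =>
    obtain ⟨ε, hε, h₁⟩ := hv
    obtain ⟨δ, hδ, h₂⟩ := hw
    refine ⟨ε * δ / (ε + δ), by positivity, ?_⟩
    have := hconv h₁ h₂ (a := δ / (ε + δ)) (b := ε / (ε + δ)) (by positivity) (by positivity)
      (by field_simp; ring)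
    convert this using 1
    match_scalars <;> field_simp
    ring
  | smul a v _ hv =>
    obtain ⟨ε, hε, h⟩ := hv
    rw [← Nonneg.coe_smul]
    rcases a.2.eq_or_lt with h0 | h0
    · exact ⟨1, one_pos, by simpa [← h0] using hx⟩
    · exact ⟨ε / a, by positivity, by rwa [smul_smul, div_mul_cancel₀ _ h0.ne']⟩

variable [FiniteDimensional ℝ V]

/-- If every face through `x` contains `F`, each functional maximal at `x` is maximal at every `y ∈
F`. So `x - y` is a tangent direction at `x`, and the segment from `y` can be prolonged past `x`. -/
theorem IsFace.mem_ri_iff (hP : IsPolytope P) (hF : IsFace P F) :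
    x ∈ intrinsicInterior ℝ F ↔ x ∈ F ∧ ∀ G, IsFace P G → x ∈ G → F ⊆ G := by
  refine ⟨fun hx => ⟨intrinsicInterior_subset hx, fun G hG => hG.subset_of_mem_ri hF.subset hx⟩,
    fun ⟨hxF, h⟩ => (mem_intrinsicInterior_iff (hF.convex hP.convex)).2 ⟨hxF, fun y hy => ?_⟩⟩
  obtain ⟨ε, hε, hmem⟩ := exists_add_smul_mem_polytope hP (hF.subset hxF) (v := x - y)
    fun l hl => by
      have := (h _ (isFace_toExposed hl) hl hy).2 x hl.1
      rw [map_sub]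
      linarith
  refine ⟨ε, hε, ?_⟩
  obtain ⟨_, l, rfl⟩ := hF
  refine ⟨hmem, fun z hz => (hxF.2 z hz).trans ?_⟩
  have := hxF.2 y hy.1
  have := mul_nonneg hε.le (sub_nonneg.2 this)
  simp only [map_add, map_smul, map_sub, smul_eq_mul]
  linarith

theorem IsFace.exists_mem_ri (hP : IsPolytope P) (hF : IsFace P F) :
    (intrinsicInterior ℝ F).Nonempty :=
  Set.Nonempty.intrinsicInterior (hF.convex hP.convex) hF.1

theorem IsFace.mem_normalCone_iff (hP : IsPolytope P) (hF : IsFace P F)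
    (hx : x ∈ intrinsicInterior ℝ F) : l ∈ normalCone P F ↔ x ∈ l.toExposed P :=
  ⟨fun h => h (intrinsicInterior_subset hx),
    fun h => ((hF.mem_ri_iff hP).1 hx).2 _ (isFace_toExposed h) h⟩

/-- For `x ∈ relint F` the normal cone is the polar of the finitely many vectors `s - x`, so
Minkowski's theorem applies. -/
theorem exists_fg_normalCone (hP : IsPolytope P) (hF : IsFace P F) :
    ∃ K : PointedCone ℝ (V →L[ℝ] ℝ), K.FG ∧ (K : Set (V →L[ℝ] ℝ)) = normalCone P F := by
  obtain ⟨x, hx⟩ := hF.exists_mem_ri hP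
  have hxP := hF.subset (intrinsicInterior_subset hx)
  have hN : ∀ l, l ∈ normalCone P F ↔ x ∈ l.toExposed P := fun l => hF.mem_normalCone_iff hP hx
  obtain ⟨S, hS, _, rfl⟩ := hP
  obtain ⟨K, hK, hmem⟩ := exists_fg_of_finset_dual (hS.image fun s => s - x)
  refine ⟨K, hK, ?_⟩
  ext l
  rw [hN, SetLike.mem_coe, hmem, forall_mem_image]
  constructor
  · intro h
    have hsub : convexHull ℝ S ⊆ {y | l y ≤ l x} := by
      refine convexHull_min (fun s hs => ?_) (convex_halfSpace_le l.isLinear _)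
      simpa using h hs
    exact ⟨hxP, hsub⟩
  · intro h s hs
    simpa using h.2 s (subset_convexHull ℝ S hs)

/-- Prolonging past `l` from a functional that exposes `F` shows that `l` is maximal nowhere else.
Conversely, if `l` exposes `F`, its strict inequalities at the generators outside `F` survive small
perturbations. -/
theorem IsFace.mem_ri_normalCone_iff (hP : IsPolytope P) (hF : IsFace P F) :
    l ∈ intrinsicInterior ℝ (normalCone P F) ↔ l.toExposed P = F := by
  rw [mem_intrinsicInterior_iff convex_normalCone]
  constructor
  · rintro ⟨hl, h⟩
    obtain ⟨x, hx⟩ := hF.1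
    refine Subset.antisymm (fun y hy => ?_) hl
    obtain ⟨_, m, rfl⟩ := hF
    obtain ⟨ε, hε, h⟩ := h m (subset_refl (m.toExposed P))
    have h₁ := (h hx).2 y hy.1
    have h₂ := (hl hx).2 y hy.1
    have h₃ := hy.2 x hx.1
    simp only [add_apply, smul_apply, sub_apply, smul_eq_mul] at h₁
    have h₄ : m x ≤ m y := by nlinarith
    exact ⟨hy.1, fun z hz => (hx.2 z hz).trans h₄⟩
  · intro hl
    refine ⟨fun x hx => hl ▸ hx, fun m hm => ?_⟩
    obtain ⟨x, hx⟩ := hF.exists_mem_ri hP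
    have hN : ∀ l, l ∈ normalCone P F ↔ x ∈ l.toExposed P := fun l => hF.mem_normalCone_iff hP hx
    have hxl : x ∈ l.toExposed P := hl ▸ intrinsicInterior_subset hx
    have hxm : x ∈ m.toExposed P := hm (intrinsicInterior_subset hx)
    simp only [hN]
    obtain ⟨S, hS, _, rfl⟩ := hP
    have key : ∀ s ∈ S, ∀ᶠ ε in nhdsWithin (0 : ℝ) (Ioi 0),
        (l + ε • (l - m)) s ≤ (l + ε • (l - m)) x := by
      intro s hs
      have hsP := subset_convexHull ℝ S hs
      simp only [add_apply, smul_apply, sub_apply, smul_eq_mul]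
      rcases (hxl.2 s hsP).eq_or_lt with h | h
      · have hsF : s ∈ F := hl ▸ ⟨hsP, fun y hy => (hxl.2 y hy).trans h.ge⟩
        have := (hm hsF).2 x hxl.1
        filter_upwards [self_mem_nhdsWithin] with ε (hε : 0 < ε)
        rw [h]
        nlinarith
      · have hc : Continuous fun ε : ℝ => (l x + ε * (l x - m x)) - (l s + ε * (l s - m s)) := by
          fun_prop
        have h0 := hc.continuousAt.eventually_mem (x := 0) (s := Ioi 0)
          (Ioi_mem_nhds (by simpa using h))
        filter_upwards [nhdsWithin_le_nhds h0] with ε hε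
        have := mem_Ioi.1 hε
        linarith
    obtain ⟨ε, hε, hpos⟩ := (((Filter.eventually_all_finite hS).2 key).and
      self_mem_nhdsWithin).exists
    refine ⟨ε, hpos, hxl.1, ?_⟩
    have hsub : convexHull ℝ S ⊆ {y | (l + ε • (l - m)) y ≤ (l + ε • (l - m)) x} :=
      convexHull_min hε (convex_halfSpace_le (l + ε • (l - m)).isLinear _)
    exact hsub

end Faces

/-! ### Fibres, minimal faces and strict complementarity -/

section Fibers

variable {V W : Type*} [NormedAddCommGroup V] [NormedSpace ℝ V]
  [NormedAddCommGroup W] [NormedSpace ℝ W]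
  {P F : Set V} {π : V →L[ℝ] W} {q : W} {ψ : KerDual π} {x : V} {l m : V →L[ℝ] ℝ}

/-- `π^∨` as a linear map. -/
def dualProjₗ (π : V →L[ℝ] W) : (V →L[ℝ] ℝ) →ₗ[ℝ] KerDual π where
  toFun := dualProj π
  map_add' _ _ := rfl
  map_smul' _ _ := rfl

theorem dualProj_apply (k : LinearMap.ker π.toLinearMap) : dualProj π l k = l k := rfl

theorem map_add_ker (k : LinearMap.ker π.toLinearMap) : π (x + k) = π x := by
  have : π (k : V) = 0 := k.2
  rw [map_add, this, add_zero]

theorem fiberFace_eq_toExposed : fiberFace P π q (dualProj π l) = l.toExposed (P ∩ π ⁻¹' {q}) := by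
  ext x
  constructor
  · rintro ⟨hx, rfl, h⟩
    refine ⟨⟨hx, rfl⟩, fun y ⟨hy, hyx⟩ => ?_⟩
    have hk : y - x ∈ LinearMap.ker π.toLinearMap := by
      have : π y = π x := hyx
      simp [this]
    have := h ⟨y - x, hk⟩ (by simpa using hy)
    simpa [dualProj_apply] using this
  · rintro ⟨⟨hx, hxq⟩, h⟩
    refine ⟨hx, hxq, fun k hk => ?_⟩
    have := h (x + k) ⟨hk, (map_add_ker k).trans hxq⟩
    simpa [dualProj_apply] using this

theorem inter_fiber_subset_fiberFace (hl : l ∈ normalCone P F) :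
    F ∩ π ⁻¹' {q} ⊆ fiberFace P π q (dualProj π l) := by
  rw [fiberFace_eq_toExposed]
  exact fun x ⟨hx, hxq⟩ => ⟨⟨(hl hx).1, hxq⟩, fun y hy => (hl hx).2 y hy.1⟩

theorem fiberFace_eq_inter (hl : l.toExposed P = F) (hq : q ∈ π '' F) :
    fiberFace P π q (dualProj π l) = F ∩ π ⁻¹' {q} := by
  refine Subset.antisymm ?_ (inter_fiber_subset_fiberFace hl.ge)
  rw [fiberFace_eq_toExposed]
  obtain ⟨x, hx, hxq⟩ := hq
  rintro y ⟨⟨hy, hyq⟩, h⟩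
  rw [← hl] at hx ⊢
  exact ⟨⟨hy, fun z hz => (hx.2 z hz).trans (h x ⟨hx.1, hxq⟩)⟩, hyq⟩

theorem fiberFace_subset : fiberFace P π q ψ ⊆ P := fun _ hx => hx.1

theorem fiberFace_subset_minFace : fiberFace P π q ψ ⊆ minFace P π q ψ :=
  subset_sInter fun _ hF => hF.2

theorem minFace_subset (hF : IsFace P F) (h : fiberFace P π q ψ ⊆ F) : minFace P π q ψ ⊆ F :=
  sInter_subset_of_mem ⟨hF, h⟩

variable [FiniteDimensional ℝ V]

theorem dualProj_surjective : Function.Surjective (dualProj π) := fun ψ => by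
  obtain ⟨g, hg⟩ := LinearMap.exists_extend ψ.toLinearMap
  refine ⟨LinearMap.toContinuousLinearMap g, ?_⟩
  ext k
  exact LinearMap.congr_fun hg k

theorem ri_dualProj_image :
    intrinsicInterior ℝ (dualProj π '' normalCone P F) =
      dualProj π '' intrinsicInterior ℝ (normalCone P F) :=
  intrinsicInterior_image_linearMap (E := V →L[ℝ] ℝ) (E' := KerDual π) (dualProjₗ π)
    convex_normalCone

variable (hP : IsPolytope P)
include hP

theorem fiberFace_nonempty (hq : q ∈ π '' P) : (fiberFace P π q ψ).Nonempty := by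
  obtain ⟨l, rfl⟩ := dualProj_surjective ψ
  rw [fiberFace_eq_toExposed]
  obtain ⟨x, hx, hxq⟩ := hq
  have hc : IsCompact (P ∩ π ⁻¹' {q}) :=
    hP.isCompact.inter_right (isClosed_singleton.preimage π.continuous)
  obtain ⟨y, hy, h⟩ := hc.exists_isMaxOn ⟨x, hx, hxq⟩ l.continuous.continuousOn
  exact ⟨y, hy, h⟩

theorem convex_fiberFace : Convex ℝ (fiberFace P π q ψ) := by
  obtain ⟨l, rfl⟩ := dualProj_surjective ψ
  rw [fiberFace_eq_toExposed]
  exact ContinuousLinearMap.toExposed.isExposed.convex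
    (hP.convex.inter ((convex_singleton q).linear_preimage π.toLinearMap))

theorem isFace_minFace (hq : q ∈ π '' P) : IsFace P (minFace P π q ψ) :=
  isFace_sInter hP (fiberFace_nonempty hP hq) fiberFace_subset

theorem exists_mem_fiberFace_mem_ri (hq : q ∈ π '' P) :
    ∃ x ∈ fiberFace P π q ψ, x ∈ intrinsicInterior ℝ (minFace P π q ψ) := by
  obtain ⟨x, hx⟩ := Set.Nonempty.intrinsicInterior (convex_fiberFace hP (ψ := ψ))
    (fiberFace_nonempty hP hq)
  have hxX := intrinsicInterior_subset hx
  refine ⟨x, hxX, ((isFace_minFace hP hq).mem_ri_iff hP).2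
    ⟨fiberFace_subset_minFace hxX,
      fun G hG hxG => minFace_subset hG (hG.subset_of_mem_ri fiberFace_subset hx hxG)⟩⟩

theorem exists_fg_dualProj (π : V →L[ℝ] W) (hF : IsFace P F) :
    ∃ K : PointedCone ℝ (KerDual π), K.FG ∧ (K : Set (KerDual π)) = dualProj π '' normalCone P F := by
  obtain ⟨K, hK, h⟩ := exists_fg_normalCone hP hF
  refine ⟨K.map (dualProjₗ π), Submodule.FG.map _ hK, ?_⟩
  rw [PointedCone.coe_map, h]
  rfl

theorem mem_ri_dualProj_iff (hF : IsFace P F) :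
    ψ ∈ intrinsicInterior ℝ (dualProj π '' normalCone P F) ↔
      ∃ l, l.toExposed P = F ∧ dualProj π l = ψ := by
  rw [ri_dualProj_image]
  exact exists_congr fun l => and_congr_left fun _ => hF.mem_ri_normalCone_iff hP

/-- Strict complementarity. -/
theorem mem_ri_dualProj_normalCone_minFace (hq : q ∈ π '' P) :
    ψ ∈ intrinsicInterior ℝ (dualProj π '' normalCone P (minFace P π q ψ)) := by
  obtain ⟨x, hx, hxi⟩ := exists_mem_fiberFace_mem_ri hP (ψ := ψ) hq
  have hF : IsFace P (minFace P π q ψ) := isFace_minFace hP hq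
  obtain ⟨K, hK, hKN⟩ := exists_fg_dualProj hP π hF
  have hN : ∀ l, l ∈ normalCone P (minFace P π q ψ) ↔ x ∈ l.toExposed P :=
    fun l => hF.mem_normalCone_iff hP hxi
  -- If `k` is nonnegative on the projected normal cone, then `-k` is a tangent direction of `P` at
  -- `x`. A `k` separating `ψ` from the cone would then improve `ψ` along the fibre.
  have key : ∀ k : LinearMap.ker π.toLinearMap,
      (∀ φ ∈ dualProj π '' normalCone P (minFace P π q ψ), 0 ≤ φ k) →
        ∃ ε > (0 : ℝ), x + ε • -(k : V) ∈ P := by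
    intro k hk
    refine exists_add_smul_mem_polytope hP hx.1 fun l hl => ?_
    have := hk _ (mem_image_of_mem _ ((hN l).2 hl))
    rw [dualProj_apply] at this
    simpa using this
  have hmem : ψ ∈ dualProj π '' normalCone P (minFace P π q ψ) := by
    by_contra hψ
    obtain ⟨k, hk, hkψ⟩ := exists_eval_neg_of_notMem_of_fg hK hKN hψ
    obtain ⟨ε, hε, h⟩ := key k hk
    have := hx.2.2 (ε • -k) (by simpa using h)
    rw [map_smul, map_neg, smul_eq_mul] at this
    nlinarith
  by_contra hψ
  obtain ⟨k, hk, hkψ, _, ⟨m, hm, rfl⟩, hpos⟩ :=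
    exists_eval_supporting_of_notMem_intrinsicInterior hK hKN hmem hψ
  obtain ⟨ε, hε, h⟩ := key k hk
  -- Since `ψ k = 0`, the moved point is still optimal and so lies in the minimal face, where `m` is
  -- maximal; this contradicts `m k > 0`.
  have hy : x + ε • -(k : V) ∈ fiberFace P π q ψ := by
    refine ⟨h, ?_, fun k' hk' => ?_⟩
    · have := map_add_ker (x := x) (ε • -k)
      exact this.trans hx.2.1
    · have := hx.2.2 (ε • -k + k') (by simpa [add_assoc] using hk')
      rwa [map_add, map_smul, map_neg, hkψ, neg_zero, smul_zero, zero_add] at this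
  have h₁ := (hm (fiberFace_subset_minFace hy)).2 x hx.1
  rw [dualProj_apply] at hpos
  simp only [map_add, map_smul, map_neg, smul_eq_mul] at h₁
  nlinarith

theorem minFace_subset_of_mem_ri (hF : IsFace P F) (hq : q ∈ π '' F)
    (hψ : ψ ∈ intrinsicInterior ℝ (dualProj π '' normalCone P F)) : minFace P π q ψ ⊆ F := by
  obtain ⟨l, hl, rfl⟩ := (mem_ri_dualProj_iff hP hF).1 hψ
  refine minFace_subset hF ?_
  rw [fiberFace_eq_inter hl hq]
  exact inter_subset_left

variable [FiniteDimensional ℝ W]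

theorem ri_image (hF : IsFace P F) :
    intrinsicInterior ℝ (π '' F) = π '' intrinsicInterior ℝ F :=
  intrinsicInterior_image_linearMap π.toLinearMap (hF.convex hP.convex)

theorem mem_ri_image_minFace (hq : q ∈ π '' P) :
    q ∈ intrinsicInterior ℝ (π '' minFace P π q ψ) := by
  obtain ⟨x, hx, hxi⟩ := exists_mem_fiberFace_mem_ri hP (ψ := ψ) hq
  rw [ri_image hP (isFace_minFace hP hq)]
  exact ⟨x, hxi, hx.2.1⟩

theorem subset_minFace_of_mem_ri (hF : IsFace P F) (hq : q ∈ intrinsicInterior ℝ (π '' F))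
    (hψ : ψ ∈ dualProj π '' normalCone P F) : F ⊆ minFace P π q ψ := by
  rw [ri_image hP hF] at hq
  obtain ⟨x, hx, rfl⟩ := hq
  obtain ⟨l, hl, rfl⟩ := hψ
  have hxF := intrinsicInterior_subset hx
  exact ((hF.mem_ri_iff hP).1 hx).2 _ (isFace_minFace hP (mem_image_of_mem π (hF.subset hxF)))
    (fiberFace_subset_minFace (inter_fiber_subset_fiberFace hl ⟨hxF, rfl⟩))

theorem fiberFace_eq_minFace_inter (hq : q ∈ π '' P) :
    fiberFace P π q ψ = minFace P π q ψ ∩ π ⁻¹' {q} := by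
  have hF : IsFace P (minFace P π q ψ) := isFace_minFace hP hq
  obtain ⟨l, hl, h⟩ := (mem_ri_dualProj_iff hP hF).1 (mem_ri_dualProj_normalCone_minFace hP hq)
  have := fiberFace_eq_inter hl (intrinsicInterior_subset (mem_ri_image_minFace hP hq))
  rwa [h] at this

variable (π) in
/-- The images of the faces of `P` and of their normal cones. -/
def facePairing : FacePairing (Set V) W (KerDual π) where
  I := faces P
  le := (· ⊆ ·)
  A F := π '' F
  B F := dualProj π '' normalCone P F
  X := π '' P
  Y := univ
  F := minFace P π
  finite := finite_faces hP
  antisymm _ _ _ _ h h' := Subset.antisymm h h'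
  convexA _ hF := (IsFace.convex hP.convex hF).linear_image π.toLinearMap
  closedA F hF := by
    obtain ⟨_, l, rfl⟩ := hF
    exact ((ContinuousLinearMap.toExposed.isExposed.isCompact hP.isCompact).image
      π.continuous).isClosed
  nonemptyA _ hF := hF.1.image _
  subA _ hF := image_mono (IsFace.subset hF)
  convexB _ _ := convex_normalCone.linear_image (dualProjₗ π)
  closedB F hF := by
    obtain ⟨K, hK, h⟩ := exists_fg_dualProj hP π hF
    rw [← h]
    exact isClosed_of_fg (E := KerDual π) hK
  nonemptyB F hF := by
    obtain ⟨_, l, rfl⟩ := hF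
    exact ⟨_, l, subset_refl (l.toExposed P), rfl⟩
  subB _ _ := subset_univ _
  nonemptyX := hP.nonempty.image _
  nonemptyY := univ_nonempty
  monoA _ _ _ _ h := image_mono h
  antiB _ _ _ _ h := image_mono (normalCone_anti h)
  F_mem _ hq _ _ := isFace_minFace hP hq
  F_iff q hq ψ _ F hF := by
    refine ⟨?_, fun ⟨h₁, h₂⟩ => Subset.antisymm
      (minFace_subset_of_mem_ri hP hF (intrinsicInterior_subset h₁) h₂)
      (subset_minFace_of_mem_ri hP hF h₁ (intrinsicInterior_subset h₂))⟩
    rintro rfl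
    exact ⟨mem_ri_image_minFace hP hq, mem_ri_dualProj_normalCone_minFace hP hq⟩
  F_le _ hF _ hq _ hψ := minFace_subset_of_mem_ri hP hF hq hψ
  le_F _ hF _ hq _ hψ := subset_minFace_of_mem_ri hP hF hq hψ

end Fibers

/-! ### Translation of strings, virtual cells and their orders into the symmetric model -/

section Translation

variable {V W : Type*} [NormedAddCommGroup V] [NormedSpace ℝ V]
  [NormedAddCommGroup W] [NormedSpace ℝ W]
  {P F G : Set V} {π : V →L[ℝ] W} {q p : W} {ψ φ : KerDual π} {x : V} {l m : V →L[ℝ] ℝ}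

theorem cellOf_mem_cells (hq : q ∈ π '' P) : cellOf P π q ∈ cells P π := mem_image_of_mem _ hq

theorem coneOf_mem_cones : coneOf P π ψ ∈ cones P π := mem_range_self _

variable (P π) in
/-- The map `Φ` on points defines the same faces as the map `Ψ` on cells. -/
def RepresentsOnCells (Ψ : cells P π → KerDual π) (Φ : W → KerDual π) : Prop :=
  ∀ c : cells P π, ∀ q ∈ intrinsicInterior ℝ (c : Set W),
    minFace P π q (Ψ c) = minFace P π q (Φ q)

variable (P π) in
/-- The map `μ` on linear functions defines the same faces as the map `κ` on cones. -/
def RepresentsOnCones (κ : cones P π → π '' P) (μ : KerDual π → W) : Prop :=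
  ∀ σ : cones P π, ∀ ψ ∈ intrinsicInterior ℝ (σ : Set (KerDual π)),
    minFace P π (κ σ) ψ = minFace P π (μ ψ) ψ

theorem conesOf_stringOf (Ψ : cells P π → KerDual π) :
    conesOf P (stringOf P π Ψ) = virtualConeOf P π Ψ := by
  ext C
  constructor
  · rintro ⟨_, ⟨c, q, hq, rfl⟩, rfl⟩
    exact ⟨c, q, hq, rfl⟩
  · rintro ⟨c, q, hq, rfl⟩
    exact ⟨_, ⟨c, q, hq, rfl⟩, rfl⟩

/-- The same maps `Ψ` define both sides, so this half of the correspondence uses no geometry. -/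
theorem virtualCones_eq_image : virtualCones P π = conesOf P '' strings P π := by
  ext C
  constructor
  · rintro ⟨Ψ, hΨ, rfl⟩
    exact ⟨_, ⟨Ψ, hΨ, rfl⟩, conesOf_stringOf Ψ⟩
  · rintro ⟨_, ⟨Ψ, hΨ, rfl⟩, rfl⟩
    exact ⟨Ψ, hΨ, conesOf_stringOf Ψ⟩

theorem injOn_conesOf : InjOn (conesOf P) {A | A ⊆ faces P} := fun _ hA _ hB h =>
  (injOn_normalCone.image_eq_image_iff hA hB).1 h

variable [FiniteDimensional ℝ V] [FiniteDimensional ℝ W] (hP : IsPolytope P)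
include hP

theorem cellOf_eq_cell (hq : q ∈ π '' P) : cellOf P π q = (facePairing π hP).cell q := by
  ext p
  constructor
  · intro h
    exact ⟨h _ ⟨P, isFace_self hP.nonempty, rfl, hq⟩, fun F hF hqF => h _ ⟨F, hF, rfl, hqF⟩⟩
  · rintro ⟨_, h⟩ _ ⟨F, hF, rfl, hqF⟩
    exact h F hF hqF

theorem coneOf_eq_cell : coneOf P π ψ = (facePairing π hP).swap.cell ψ := by
  ext p
  constructor
  · intro h
    exact ⟨mem_univ _, fun F hF hqF => h _ ⟨F, hF, rfl, hqF⟩⟩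
  · rintro ⟨_, h⟩ _ ⟨F, hF, rfl, hqF⟩
    exact h F hF hqF

theorem mem_ri_cellOf_self (hq : q ∈ π '' P) : q ∈ intrinsicInterior ℝ (cellOf P π q) := by
  rw [cellOf_eq_cell hP hq]
  exact FacePairing.mem_ri_cell_self hq

theorem mem_ri_coneOf_self : ψ ∈ intrinsicInterior ℝ (coneOf P π ψ) := by
  rw [coneOf_eq_cell hP]
  exact FacePairing.mem_ri_cell_self (D := (facePairing π hP).swap) (mem_univ ψ)

theorem cellOf_eq_of_mem_ri {c : Set W} (hc : c ∈ cells P π) (hq : q ∈ intrinsicInterior ℝ c) :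
    q ∈ π '' P ∧ cellOf P π q = c := by
  obtain ⟨p, hp, rfl⟩ := hc
  rw [cellOf_eq_cell hP hp] at hq ⊢
  have hqX := (intrinsicInterior_subset hq).1
  exact ⟨hqX, by rw [cellOf_eq_cell hP hqX, FacePairing.cell_eq_of_mem_ri hp hq]⟩

theorem coneOf_eq_of_mem_ri {σ : Set (KerDual π)} (hσ : σ ∈ cones P π)
    (hψ : ψ ∈ intrinsicInterior ℝ σ) : coneOf P π ψ = σ := by
  obtain ⟨φ, rfl⟩ := hσ
  simp only [coneOf_eq_cell hP] at hψ ⊢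
  exact FacePairing.cell_eq_of_mem_ri (D := (facePairing π hP).swap) (mem_univ φ) hψ

/-- A larger optimal face of the fibre forces a larger minimal face, and strict complementarity
places `φ` in its projected normal cone. Conversely, a functional maximal on the minimal face is
maximal on the optimal face of the fibre. -/
theorem fiberConeOf_eq (hq : q ∈ π '' P) :
    fiberConeOf P π q ψ = dualProj π '' normalCone P (minFace P π q ψ) := by
  have hF : IsFace P (minFace P π q ψ) := isFace_minFace hP hq
  refine Subset.antisymm (fun φ hφ => ?_) ?_
  · have h : fiberFace P π q ψ ⊆ fiberFace P π q φ :=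
      hφ _ ⟨⟨ψ, rfl⟩, subset_refl (fiberFace P π q ψ)⟩
    exact image_mono (normalCone_anti (minFace_subset (isFace_minFace hP hq)
      (h.trans fiberFace_subset_minFace)))
      (intrinsicInterior_subset (mem_ri_dualProj_normalCone_minFace hP hq))
  · rintro _ ⟨m, hm, rfl⟩ _ ⟨⟨ψ', rfl⟩, h⟩
    have h' : fiberFace P π q ψ' ⊆ fiberFace P π q ψ := h
    rw [fiberFace_eq_minFace_inter hP (ψ := ψ) hq] at h'
    exact h'.trans (inter_fiber_subset_fiberFace hm)

theorem stringOf_eq_family {Ψ : cells P π → KerDual π} {Φ : W → KerDual π}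
    (h : RepresentsOnCells P π Ψ Φ) : stringOf P π Ψ = (facePairing π hP).family Φ := by
  ext F
  constructor
  · rintro ⟨c, q, hq, rfl⟩
    exact ⟨q, (cellOf_eq_of_mem_ri hP c.2 hq).1, h c q hq⟩
  · rintro ⟨q, hq, rfl⟩
    exact ⟨⟨_, cellOf_mem_cells hq⟩, q, mem_ri_cellOf_self hP hq,
      (h ⟨_, cellOf_mem_cells hq⟩ q (mem_ri_cellOf_self hP hq)).symm⟩

theorem virtualCellOf_eq_family {κ : cones P π → π '' P} {μ : KerDual π → W}
    (h : RepresentsOnCones P π κ μ) :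
    virtualCellOf P π κ = (facePairing π hP).swap.family μ := by
  ext F
  constructor
  · rintro ⟨σ, ψ, hψ, rfl⟩
    exact ⟨ψ, mem_univ _, h σ ψ hψ⟩
  · rintro ⟨ψ, -, rfl⟩
    exact ⟨⟨_, coneOf_mem_cones⟩, ψ, mem_ri_coneOf_self hP,
      (h ⟨_, coneOf_mem_cones⟩ ψ (mem_ri_coneOf_self hP)).symm⟩

theorem coherentString_eq : coherentString P π ψ = (facePairing π hP).family fun _ => ψ :=
  stringOf_eq_family hP fun _ _ _ => rfl

theorem stringCellOf_eq (hq : q ∈ π '' P) : stringCellOf P π q ψ = π '' minFace P π q ψ := by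
  have hD := coherentString_eq hP (ψ := ψ)
  refine Subset.antisymm (sInter_subset_of_mem ⟨_, ?_, rfl, ?_⟩) ?_
  · rw [hD]
    exact ⟨q, hq, rfl⟩
  · exact intrinsicInterior_subset (mem_ri_image_minFace hP hq)
  · refine subset_sInter ?_
    rintro _ ⟨F, hF, rfl, hqF⟩
    rw [hD] at hF
    obtain ⟨p, hp, rfl⟩ := hF
    exact image_mono (minFace_subset_of_mem_ri hP (isFace_minFace hP hp) hqF
      (mem_ri_dualProj_normalCone_minFace hP hp))

theorem isCoherentOnCells_iff {Ψ : cells P π → KerDual π} {Φ : W → KerDual π}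
    (h : RepresentsOnCells P π Ψ Φ) :
    IsCoherentOnCells P π Ψ ↔ (facePairing π hP).Coherent Φ := by
  rw [FacePairing.coherent_iff fun _ _ => mem_univ _]
  constructor
  · intro hΨ q hq p hp
    have hqX : q ∈ π '' P := hq
    have hpX : p ∈ π '' P := hp.1
    have hqi := mem_ri_cellOf_self hP hqX
    have hpi := mem_ri_cellOf_self hP hpX
    have hsub : cellOf P π p ⊆ cellOf P π q := by
      rw [cellOf_eq_cell hP hpX, cellOf_eq_cell hP hqX]
      exact FacePairing.cell_subset hp
    have := hΨ ⟨_, cellOf_mem_cells hqX⟩ ⟨_, cellOf_mem_cells hpX⟩ hsub q hqi p hpi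
    rw [fiberConeOf_eq hP hqX, fiberConeOf_eq hP hpX, h ⟨_, cellOf_mem_cells hqX⟩ q hqi,
      h ⟨_, cellOf_mem_cells hpX⟩ p hpi] at this
    exact this
  · intro hΦ c c' hcc q hq p hp
    obtain ⟨hqX, hqc⟩ := cellOf_eq_of_mem_ri hP c.2 hq
    obtain ⟨hpX, -⟩ := cellOf_eq_of_mem_ri hP c'.2 hp
    rw [fiberConeOf_eq hP hqX, fiberConeOf_eq hP hpX, h c q hq, h c' p hp]
    refine hΦ q hqX p ?_
    rw [← cellOf_eq_cell hP hqX, hqc]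
    exact hcc (intrinsicInterior_subset hp)

theorem isCoherentOnCones_iff {κ : cones P π → π '' P} {μ : KerDual π → W}
    (h : RepresentsOnCones P π κ μ) (hμ : ∀ ψ, μ ψ ∈ π '' P) :
    IsCoherentOnCones P π κ ↔ (facePairing π hP).swap.Coherent μ := by
  rw [FacePairing.coherent_iff fun ψ _ => hμ ψ]
  constructor
  · intro hκ ψ _ φ hφ
    have hψi := mem_ri_coneOf_self hP (ψ := ψ)
    have hφi := mem_ri_coneOf_self hP (ψ := φ)
    have hsub : coneOf P π φ ⊆ coneOf P π ψ := by
      rw [coneOf_eq_cell hP, coneOf_eq_cell hP]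
      exact FacePairing.cell_subset hφ
    have := hκ ⟨_, coneOf_mem_cones⟩ ⟨_, coneOf_mem_cones⟩ hsub ψ hψi φ hφi
    rw [stringCellOf_eq hP (κ _).2, stringCellOf_eq hP (κ _).2, h ⟨_, coneOf_mem_cones⟩ ψ hψi,
      h ⟨_, coneOf_mem_cones⟩ φ hφi] at this
    exact this
  · intro hμc σ σ' hσσ ψ hψ φ hφ
    have hσ := coneOf_eq_of_mem_ri hP σ.2 hψ
    rw [stringCellOf_eq hP (κ _).2, stringCellOf_eq hP (κ _).2, h σ ψ hψ, h σ' φ hφ]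
    refine hμc ψ (mem_univ _) φ ?_
    rw [← coneOf_eq_cell hP, hσ]
    exact hσσ (intrinsicInterior_subset hφ)

/-- Choose a point in each cell with that cell as its cell; coherence makes the value of `Φ` there
valid on the whole cell. -/
theorem exists_representsOnCells_left {Φ : W → KerDual π} (hΦ : (facePairing π hP).Coherent Φ) :
    ∃ Ψ : cells P π → KerDual π, RepresentsOnCells P π Ψ Φ := by
  choose r hr hrc using fun c : cells P π => c.2
  refine ⟨fun c => Φ (r c), fun c q hq => hΦ.2 _ (hr c) q ?_⟩
  rw [← cellOf_eq_cell hP (hr c), hrc]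
  exact intrinsicInterior_subset hq

theorem exists_representsOnCones_left {μ : KerDual π → W}
    (hμ : (facePairing π hP).swap.Coherent μ) :
    ∃ κ : cones P π → π '' P, RepresentsOnCones P π κ μ := by
  choose r hr using fun σ : cones P π => σ.2
  refine ⟨fun σ => ⟨μ (r σ), hμ.1 (mem_univ _)⟩, fun σ ψ hψ => hμ.2 _ (mem_univ _) ψ ?_⟩
  rw [← coneOf_eq_cell hP, hr]
  exact intrinsicInterior_subset hψ

theorem exists_representsOnCells_right (Ψ : cells P π → KerDual π) :
    ∃ Φ : W → KerDual π, RepresentsOnCells P π Ψ Φ := by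
  classical
  -- The value `0` off `Q` is immaterial: coherence and families only involve points of `Q`.
  refine ⟨fun q => if hq : q ∈ π '' P then Ψ ⟨cellOf P π q, cellOf_mem_cells hq⟩ else 0,
    fun c q hq => ?_⟩
  obtain ⟨hqX, hqc⟩ := cellOf_eq_of_mem_ri hP c.2 hq
  simp only [hqX, dif_pos, hqc]

theorem exists_representsOnCones_right (κ : cones P π → π '' P) :
    ∃ μ : KerDual π → W, RepresentsOnCones P π κ μ ∧ ∀ ψ, μ ψ ∈ π '' P := by
  refine ⟨fun ψ => κ ⟨coneOf P π ψ, coneOf_mem_cones⟩, fun σ ψ hψ => ?_, fun ψ => (κ _).2⟩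
  simp only [coneOf_eq_of_mem_ri hP σ.2 hψ]

theorem mem_strings_iff {A : Set (Set V)} :
    A ∈ strings P π ↔ ∃ Φ, (facePairing π hP).Coherent Φ ∧ A = (facePairing π hP).family Φ := by
  constructor
  · rintro ⟨Ψ, hΨ, rfl⟩
    obtain ⟨Φ, hΦ⟩ := exists_representsOnCells_right hP Ψ
    exact ⟨Φ, (isCoherentOnCells_iff hP hΦ).1 hΨ, stringOf_eq_family hP hΦ⟩
  · rintro ⟨Φ, hΦ, rfl⟩
    obtain ⟨Ψ, hΨ⟩ := exists_representsOnCells_left hP hΦ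
    exact ⟨Ψ, (isCoherentOnCells_iff hP hΨ).2 hΦ, (stringOf_eq_family hP hΨ).symm⟩

theorem mem_virtualCells_iff {A : Set (Set V)} :
    A ∈ virtualCells P π ↔
      ∃ μ, (facePairing π hP).swap.Coherent μ ∧ A = (facePairing π hP).swap.family μ := by
  constructor
  · rintro ⟨κ, hκ, rfl⟩
    obtain ⟨μ, hμ, hμQ⟩ := exists_representsOnCones_right hP κ
    exact ⟨μ, (isCoherentOnCones_iff hP hμ hμQ).1 hκ, virtualCellOf_eq_family hP hμ⟩
  · rintro ⟨μ, hμ, rfl⟩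
    obtain ⟨κ, hκ⟩ := exists_representsOnCones_left hP hμ
    exact ⟨κ, (isCoherentOnCones_iff hP hκ fun ψ => hμ.1 (mem_univ ψ)).2 hμ,
      (virtualCellOf_eq_family hP hκ).symm⟩

theorem strings_subset {A : Set (Set V)} (hA : A ∈ strings P π) : A ⊆ faces P := by
  obtain ⟨Φ, hΦ, rfl⟩ := (mem_strings_iff hP).1 hA
  exact FacePairing.family_subset hΦ

theorem virtualCells_subset {A : Set (Set V)} (hA : A ∈ virtualCells P π) : A ⊆ faces P := by
  obtain ⟨Φ, hΦ, rfl⟩ := (mem_virtualCells_iff hP).1 hA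
  exact FacePairing.family_subset hΦ

theorem virtualConeLE_iff {Φ Φ' : W → KerDual π} (hΦ : (facePairing π hP).Coherent Φ)
    (hΦ' : (facePairing π hP).Coherent Φ') :
    VirtualConeLE P π (conesOf P ((facePairing π hP).family Φ))
      (conesOf P ((facePairing π hP).family Φ')) ↔
      ∀ q ∈ π '' P, minFace P π q (Φ' q) ⊆ minFace P π q (Φ q) := by
  constructor
  · rintro ⟨Ψ, Ψ', hΨ, hA, hΨ', hB, h⟩ q hq
    obtain ⟨Θ, hΘ⟩ := exists_representsOnCells_right hP Ψ
    obtain ⟨Θ', hΘ'⟩ := exists_representsOnCells_right hP Ψ'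
    have hΘc := (isCoherentOnCells_iff hP hΘ).1 hΨ
    have hΘc' := (isCoherentOnCells_iff hP hΘ').1 hΨ'
    rw [← conesOf_stringOf, stringOf_eq_family hP hΘ] at hA
    rw [← conesOf_stringOf, stringOf_eq_family hP hΘ'] at hB
    have e : minFace P π q (Φ q) = minFace P π q (Θ q) := hΦ.F_eq_of_family_eq hΘc
      (injOn_conesOf (FacePairing.family_subset hΦ) (FacePairing.family_subset hΘc) hA) hq
    have e' : minFace P π q (Φ' q) = minFace P π q (Θ' q) := hΦ'.F_eq_of_family_eq hΘc'
      (injOn_conesOf (FacePairing.family_subset hΦ') (FacePairing.family_subset hΘc') hB) hq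
    have hqi := mem_ri_cellOf_self hP hq
    have := h ⟨_, cellOf_mem_cells hq⟩ q hqi
    rw [hΘ _ q hqi, hΘ' _ q hqi, (isFace_minFace hP hq).normalCone_subset_iff] at this
    rwa [e, e']
  · intro h
    obtain ⟨Ψ, hΨ⟩ := exists_representsOnCells_left hP hΦ
    obtain ⟨Ψ', hΨ'⟩ := exists_representsOnCells_left hP hΦ'
    refine ⟨Ψ, Ψ', (isCoherentOnCells_iff hP hΨ).2 hΦ, ?_, (isCoherentOnCells_iff hP hΨ').2 hΦ',
      ?_, fun c q hq => ?_⟩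
    · rw [← conesOf_stringOf, stringOf_eq_family hP hΨ]
    · rw [← conesOf_stringOf, stringOf_eq_family hP hΨ']
    · rw [hΨ c q hq, hΨ' c q hq]
      exact normalCone_anti (h q (cellOf_eq_of_mem_ri hP c.2 hq).1)

theorem virtualCellLE_iff {μ μ' : KerDual π → W} (hμ : (facePairing π hP).swap.Coherent μ)
    (hμ' : (facePairing π hP).swap.Coherent μ') :
    VirtualCellLE P π ((facePairing π hP).swap.family μ) ((facePairing π hP).swap.family μ') ↔
      ∀ ψ, minFace P π (μ ψ) ψ ⊆ minFace P π (μ' ψ) ψ := by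
  constructor
  · rintro ⟨κ, κ', hκ, hA, hκ', hB, h⟩ ψ
    obtain ⟨θ, hθ, hθQ⟩ := exists_representsOnCones_right hP κ
    obtain ⟨θ', hθ', hθQ'⟩ := exists_representsOnCones_right hP κ'
    rw [virtualCellOf_eq_family hP hθ] at hA
    rw [virtualCellOf_eq_family hP hθ'] at hB
    have e : minFace P π (μ ψ) ψ = minFace P π (θ ψ) ψ :=
      hμ.F_eq_of_family_eq ((isCoherentOnCones_iff hP hθ hθQ).1 hκ) hA (mem_univ ψ)
    have e' : minFace P π (μ' ψ) ψ = minFace P π (θ' ψ) ψ :=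
      hμ'.F_eq_of_family_eq ((isCoherentOnCones_iff hP hθ' hθQ').1 hκ') hB (mem_univ ψ)
    have hψ := mem_ri_coneOf_self hP (ψ := ψ)
    have := h ⟨_, coneOf_mem_cones⟩ ψ hψ
    rwa [hθ _ ψ hψ, hθ' _ ψ hψ, ← e, ← e'] at this
  · intro h
    obtain ⟨κ, hκ⟩ := exists_representsOnCones_left hP hμ
    obtain ⟨κ', hκ'⟩ := exists_representsOnCones_left hP hμ'
    refine ⟨κ, κ', (isCoherentOnCones_iff hP hκ fun ψ => hμ.1 (mem_univ ψ)).2 hμ,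
      (virtualCellOf_eq_family hP hκ).symm,
      (isCoherentOnCones_iff hP hκ' fun ψ => hμ'.1 (mem_univ ψ)).2 hμ',
      (virtualCellOf_eq_family hP hκ').symm, fun σ ψ hψ => ?_⟩
    rw [hκ σ ψ hψ, hκ' σ ψ hψ]
    exact h ψ

/-- The part over `q` of the union of a locally coherent string. -/
theorem mem_sUnion_family_iff {Φ : W → KerDual π} (hΦ : (facePairing π hP).Coherent Φ) :
    x ∈ ⋃₀ (facePairing π hP).family Φ ↔ x ∈ P ∧ x ∈ minFace P π (π x) (Φ (π x)) := by
  constructor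
  · rintro ⟨_, ⟨q, hq, rfl⟩, hx⟩
    have hF : IsFace P (minFace P π q (Φ q)) := isFace_minFace hP hq
    have hxP : x ∈ P := hF.subset hx
    have hxQ : π x ∈ π '' P := mem_image_of_mem π hxP
    -- Both faces are exposed by functionals restricting to the same `ψ`, so over `π x` each cuts
    -- out the same optimal face of the fibre.
    obtain ⟨ψ, -, h₁, h₂⟩ := hΦ.exists_common hq (mem_image_of_mem π hx)
    obtain ⟨l, hl, rfl⟩ := (mem_ri_dualProj_iff hP hF).1 h₁
    obtain ⟨m, hm, hml⟩ := (mem_ri_dualProj_iff hP (isFace_minFace hP hxQ)).1 h₂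
    have h : x ∈ fiberFace P π (π x) (dualProj π l) := by
      rw [fiberFace_eq_inter hl (mem_image_of_mem π hx)]
      exact ⟨hx, rfl⟩
    rw [← hml, fiberFace_eq_inter hm (intrinsicInterior_subset (mem_ri_image_minFace hP hxQ))] at h
    exact ⟨hxP, h.1⟩
  · rintro ⟨hxP, hx⟩
    exact ⟨_, ⟨π x, mem_image_of_mem π hxP, rfl⟩, hx⟩

/-- A point over `q` in the relative interior of the minimal face detects inclusion of the whole
face. -/
theorem unionLE_family_iff {Φ Φ' : W → KerDual π} (hΦ : (facePairing π hP).Coherent Φ)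
    (hΦ' : (facePairing π hP).Coherent Φ') :
    UnionLE ((facePairing π hP).family Φ) ((facePairing π hP).family Φ') ↔
      ∀ q ∈ π '' P, minFace P π q (Φ q) ⊆ minFace P π q (Φ' q) := by
  constructor
  · intro h q hq
    obtain ⟨x, hx, hxi⟩ := exists_mem_fiberFace_mem_ri hP (ψ := Φ q) hq
    obtain ⟨hxP, rfl, -⟩ := hx
    refine (((isFace_minFace hP hq).mem_ri_iff hP).1 hxi).2 _ (isFace_minFace hP hq) ?_
    exact ((mem_sUnion_family_iff hP hΦ').1
      (h ((mem_sUnion_family_iff hP hΦ).2 ⟨hxP, intrinsicInterior_subset hxi⟩))).2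
  · intro h x hx
    rw [mem_sUnion_family_iff hP hΦ] at hx
    exact (mem_sUnion_family_iff hP hΦ').2 ⟨hx.1, h _ (mem_image_of_mem π hx.1) hx.2⟩

/-- A linear function in a normal cone `N(P, F)` whose restriction lies in the image of `N(P, G)`
belongs to `N(P, G)`, if the relative interior of `π(G)` meets `π(F)`. -/
theorem mem_normalCone_of_dualProj_mem (hG : IsFace P G) (hqF : q ∈ π '' F)
    (hqG : q ∈ intrinsicInterior ℝ (π '' G)) (hl : l ∈ normalCone P F)
    (hlG : dualProj π l ∈ dualProj π '' normalCone P G) : l ∈ normalCone P G := by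
  obtain ⟨x, hx, rfl⟩ := hqF
  rw [ri_image hP hG] at hqG
  obtain ⟨y, hy, hyx⟩ := hqG
  obtain ⟨m, hm, hml⟩ := hlG
  -- The functionals `l` and `m` agree on `ker π`, so `y` maximises `l` on the fibre. That fibre
  -- contains `x`, where `l` is maximal on all of `P`.
  have h := inter_fiber_subset_fiberFace (π := π) (q := π x) hm ⟨intrinsicInterior_subset hy, hyx⟩
  rw [hml, fiberFace_eq_toExposed] at h
  refine (hG.mem_normalCone_iff hP hy).2 ⟨h.1.1, fun z hz => ((hl hx).2 z hz).trans ?_⟩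
  exact h.2 x ⟨(hl hx).1, rfl⟩

/-- The part over `π^∨ l` of the union of the costring of a virtual cell. -/
theorem mem_sUnion_conesOf_family_iff {μ : KerDual π → W}
    (hμ : (facePairing π hP).swap.Coherent μ) :
    l ∈ ⋃₀ conesOf P ((facePairing π hP).swap.family μ) ↔
      l ∈ normalCone P (minFace P π (μ (dualProj π l)) (dualProj π l)) := by
  constructor
  · rintro ⟨_, ⟨_, ⟨ψ, -, rfl⟩, rfl⟩, hl⟩
    have hQ : ∀ ψ, μ ψ ∈ π '' P := fun ψ => hμ.1 (mem_univ ψ)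
    obtain ⟨q, -, h₁, h₂⟩ := hμ.exists_common (mem_univ ψ) (mem_image_of_mem (dualProj π) hl)
    exact mem_normalCone_of_dualProj_mem hP (isFace_minFace hP (hQ _))
      (intrinsicInterior_subset h₁) h₂ hl
      (intrinsicInterior_subset (mem_ri_dualProj_normalCone_minFace hP (hQ _)))
  · intro hl
    exact ⟨_, ⟨_, ⟨dualProj π l, mem_univ _, rfl⟩, rfl⟩, hl⟩

/-- Here the test point is a functional over `ψ` that exposes the minimal face exactly. -/
theorem unionLE_conesOf_family_iff {μ μ' : KerDual π → W}
    (hμ : (facePairing π hP).swap.Coherent μ) (hμ' : (facePairing π hP).swap.Coherent μ') :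
    UnionLE (conesOf P ((facePairing π hP).swap.family μ))
      (conesOf P ((facePairing π hP).swap.family μ')) ↔
      ∀ ψ, minFace P π (μ' ψ) ψ ⊆ minFace P π (μ ψ) ψ := by
  constructor
  · intro h ψ
    have hQ : μ ψ ∈ π '' P := hμ.1 (mem_univ ψ)
    obtain ⟨l, hl, rfl⟩ := (mem_ri_dualProj_iff hP (isFace_minFace hP hQ)).1
      (mem_ri_dualProj_normalCone_minFace hP (ψ := ψ) hQ)
    have := (mem_sUnion_conesOf_family_iff hP hμ').1
      (h ((mem_sUnion_conesOf_family_iff hP hμ).2 hl.ge))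
    exact this.trans hl.le
  · intro h l hl
    rw [mem_sUnion_conesOf_family_iff hP hμ] at hl
    exact (mem_sUnion_conesOf_family_iff hP hμ').2 (normalCone_anti (h _) hl)

end Translation

/-! ### Subdivisions into cones -/

section ConeSubdivisions

variable {E : Type*} [NormedAddCommGroup E] [NormedSpace ℝ E] {K : Set (Set E)} {X C D : Set E}
  {x : E}

theorem IsConeSubdivision.eq_of_mem_ri (hK : IsConeSubdivision K X) (hC : C ∈ K) (hD : D ∈ K)
    (hxC : x ∈ intrinsicInterior ℝ C) (hxD : x ∈ intrinsicInterior ℝ D) : C = D := by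
  obtain ⟨h₁, h₂⟩ := hK.inter_face C hC D hD
  have hx : x ∈ C ∩ D := ⟨intrinsicInterior_subset hxC, intrinsicInterior_subset hxD⟩
  exact Subset.antisymm ((h₁.subset_of_mem_ri subset_rfl hxC hx).trans inter_subset_right)
    ((h₂.subset_of_mem_ri subset_rfl hxD hx).trans inter_subset_left)

/-- Take a minimal cone containing `x`: if `x` were not in its relative interior, a supporting
functional would cut out a smaller face containing `x`, again a member of `K`. -/
theorem IsConeSubdivision.exists_mem_ri [FiniteDimensional ℝ E] (hK : IsConeSubdivision K X)
    (hx : x ∈ X) : ∃ C ∈ K, x ∈ intrinsicInterior ℝ C := by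
  obtain ⟨C₀, hC₀, hx₀⟩ : x ∈ ⋃₀ K := hK.support ▸ hx
  obtain ⟨C, ⟨hC, hxC⟩, hmin⟩ := (hK.finite.subset (sep_subset K fun C => x ∈ C)).exists_minimal
    ⟨C₀, hC₀, hx₀⟩
  refine ⟨C, hC, ?_⟩
  by_contra hxi
  obtain ⟨M, hM, rfl⟩ := hK.polyhedral C hC
  obtain ⟨t, ht, htx, y, hy, hpos⟩ := exists_supporting_of_notMem_intrinsicInterior hM hxC hxi
  have hxF : x ∈ (-t).toExposed (M : Set E) :=
    ⟨hxC, fun z hz => by simpa [htx] using ht z hz⟩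
  have := hmin ⟨hK.face_mem _ hC _ (isFace_toExposed hxF), hxF⟩ (fun z hz => hz.1) hy
  have h' := this.2 x hxC
  simp only [neg_apply, htx] at h'
  linarith

/-- Cones `B x`, one for every point `x` and containing it in the relative interior, form a complete
subdivision if `B y` is a face of `B x` for all `y ∈ B x`. -/
theorem isConeSubdivision_range [FiniteDimensional ℝ E] {B : E → Set E} (hfin : (range B).Finite)
    (hpoly : ∀ x, IsPolyhedralCone (B x)) (hri : ∀ x, x ∈ intrinsicInterior ℝ (B x))
    (hface : ∀ x, ∀ y ∈ B x, IsFace (B x) (B y)) : IsConeSubdivision (range B) univ := by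
  have hconv : ∀ x, Convex ℝ (B x) := fun x => by
    obtain ⟨M, -, hM⟩ := hpoly x
    rw [← hM]
    exact (M : ConvexCone ℝ E).convex
  have hzero : ∀ x, (0 : E) ∈ B x := fun x => by
    obtain ⟨M, -, hM⟩ := hpoly x
    rw [← hM]
    exact M.zero_mem
  refine ⟨hfin, ?_, ?_, ?_, ?_⟩
  · rintro _ ⟨x, rfl⟩
    exact hpoly x
  · rintro _ ⟨x, rfl⟩ G hG
    obtain ⟨y, hy⟩ := Set.Nonempty.intrinsicInterior (hG.convex (hconv x)) hG.1
    have hH := hface x y (hG.subset (intrinsicInterior_subset hy))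
    exact ⟨y, Subset.antisymm
      (hG.subset_of_mem_ri hH.subset (hri y) (intrinsicInterior_subset hy))
      (hH.subset_of_mem_ri hG.subset hy (intrinsicInterior_subset (hri y)))⟩
  · rintro _ ⟨x, rfl⟩ _ ⟨z, rfl⟩
    -- For `y` in the relative interior of the intersection, `B y` is a face of both cones, and it
    -- equals the intersection because each face through `y` contains it.
    obtain ⟨y, hy⟩ := Set.Nonempty.intrinsicInterior ((hconv x).inter (hconv z))
      ⟨0, hzero x, hzero z⟩
    have hym := intrinsicInterior_subset hy
    have h₁ := hface x y hym.1
    have h₂ := hface z y hym.2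
    have heq := Subset.antisymm
      (h₁.subset_of_mem_ri inter_subset_left hy (intrinsicInterior_subset (hri y)))
      (subset_inter h₁.subset h₂.subset)
    rw [heq]
    exact ⟨h₁, h₂⟩
  · exact eq_univ_of_forall fun x => ⟨B x, mem_range_self x, intrinsicInterior_subset (hri x)⟩

theorem isFace_iff_exists_eval [FiniteDimensional ℝ E] {C G : Set (E →L[ℝ] ℝ)} :
    IsFace C G ↔ G.Nonempty ∧
      ∃ x : E, ∀ l, l ∈ G ↔ l ∈ C ∧ ∀ m ∈ C, m x ≤ l x := by
  refine and_congr_right fun _ => ⟨?_, ?_⟩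
  · rintro ⟨t, rfl⟩
    obtain ⟨x, hx⟩ := exists_eval_eq t
    exact ⟨x, fun l => by simp only [mem_toExposed, hx]⟩
  · rintro ⟨x, hx⟩
    refine ⟨ContinuousLinearMap.apply ℝ ℝ x, ?_⟩
    ext l
    exact hx l

end ConeSubdivisions

section

variable {V W : Type*} [NormedAddCommGroup V] [NormedSpace ℝ V]
  [NormedAddCommGroup W] [NormedSpace ℝ W] {P F : Set V} {π : V →L[ℝ] W}

theorem zero_mem_dualProj_image (hF : F ⊆ P) : (0 : KerDual π) ∈ dualProj π '' normalCone P F :=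
  ⟨0, fun x hx => ⟨hF hx, fun y _ => by simp⟩, rfl⟩

theorem dualProj_image_sUnion_normalFan [FiniteDimensional ℝ V] (hP : IsPolytope P) :
    dualProj π '' ⋃₀ normalFan P = univ := by
  refine eq_univ_of_forall fun ψ => ?_
  obtain ⟨q, hq⟩ := hP.nonempty.image π
  have hF : minFace P π q ψ ∈ faces P := isFace_minFace hP hq
  exact image_mono (f := dualProj π)
    (subset_sUnion_of_mem (mem_image_of_mem (normalCone P) hF))
    (intrinsicInterior_subset (mem_ri_dualProj_normalCone_minFace hP hq))

end

/-! ### Costrings are the normal cones of virtual cells -/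

section Costrings

variable {V W : Type*} [NormedAddCommGroup V] [NormedSpace ℝ V] [FiniteDimensional ℝ V]
  [NormedAddCommGroup W] [NormedSpace ℝ W] [FiniteDimensional ℝ W]
  {P F G : Set V} {π : V →L[ℝ] W} {q : W} {ψ φ : KerDual π} {x y : V} {l m : V →L[ℝ] ℝ}

variable (hP : IsPolytope P)
include hP

/-- If `F ⊆ G` are faces such that the relative interiors of `π(F)` and `π(G)` meet, then the image
of `N(P, G)` is a face of the image of `N(P, F)`. -/
theorem isFace_dualProj_image (hF : IsFace P F) (hG : IsFace P G) (hFG : F ⊆ G)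
    (hqF : q ∈ intrinsicInterior ℝ (π '' F)) (hqG : q ∈ intrinsicInterior ℝ (π '' G)) :
    IsFace (dualProj π '' normalCone P F) (dualProj π '' normalCone P G) := by
  rw [ri_image hP hF] at hqF
  rw [ri_image hP hG] at hqG
  obtain ⟨x, hx, rfl⟩ := hqF
  obtain ⟨y, hy, hyx⟩ := hqG
  have hxF := intrinsicInterior_subset hx
  have hyG := intrinsicInterior_subset hy
  -- Evaluation at `y - x` is at most `0` on `N(P, F)`, with equality exactly when the functional is
  -- also maximal at `y`, that is, on `N(P, G)`.
  have hk : y - x ∈ LinearMap.ker π.toLinearMap := by simp [hyx]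
  have hval : ∀ l : V →L[ℝ] ℝ, dualProj π l ⟨y - x, hk⟩ = l y - l x := fun l => by
    rw [dualProj_apply, map_sub]
  refine isFace_iff_exists_eval.2 ⟨⟨0, zero_mem_dualProj_image hG.subset⟩, ⟨y - x, hk⟩,
    fun χ => ⟨?_, ?_⟩⟩
  · rintro ⟨m, hm, rfl⟩
    refine ⟨⟨m, normalCone_anti hFG hm, rfl⟩, ?_⟩
    rintro _ ⟨l, hl, rfl⟩
    rw [hval, hval]
    have h₁ := (hl hxF).2 y (hG.subset hyG)
    have h₂ := (hm (hFG hxF)).2 y (hG.subset hyG)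
    have h₃ := (hm hyG).2 x (hF.subset hxF)
    linarith
  · rintro ⟨⟨m, hm, rfl⟩, h⟩
    refine ⟨m, (hG.mem_normalCone_iff hP hy).2 ⟨hG.subset hyG, fun z hz => ?_⟩, rfl⟩
    have h₀ := h 0 (zero_mem_dualProj_image hF.subset)
    rw [hval, zero_apply] at h₀
    exact ((hm hxF).2 z hz).trans (by linarith)

theorem isCostring_of_coherent {μ : KerDual π → W} (hμ : (facePairing π hP).swap.Coherent μ) :
    IsCostring π (normalFan P) (conesOf P ((facePairing π hP).swap.family μ)) := by
  have hQ : ∀ ψ, μ ψ ∈ π '' P := fun ψ => hμ.1 (mem_univ ψ)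
  have hface : ∀ ψ, IsFace P (minFace P π (μ ψ) ψ) := fun ψ => isFace_minFace hP (hQ ψ)
  have hri : ∀ ψ, ψ ∈ intrinsicInterior ℝ (dualProj π '' normalCone P (minFace P π (μ ψ) ψ)) :=
    fun ψ => mem_ri_dualProj_normalCone_minFace hP (hQ ψ)
  have hfaces : ∀ ψ, ∀ φ ∈ dualProj π '' normalCone P (minFace P π (μ ψ) ψ),
      IsFace (dualProj π '' normalCone P (minFace P π (μ ψ) ψ))
        (dualProj π '' normalCone P (minFace P π (μ φ) φ)) := fun ψ φ hφ => by
    obtain ⟨q, -, h₁, h₂⟩ := hμ.exists_common (mem_univ ψ) hφ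
    exact isFace_dualProj_image hP (hface ψ) (hface φ) (hμ.le (mem_univ ψ) hφ) h₁ h₂
  have hrange : (fun s => dualProj π '' s) '' conesOf P ((facePairing π hP).swap.family μ) =
      range fun ψ => dualProj π '' normalCone P (minFace P π (μ ψ) ψ) := by
    ext s
    constructor
    · rintro ⟨_, ⟨_, ⟨ψ, -, rfl⟩, rfl⟩, rfl⟩
      exact ⟨ψ, rfl⟩
    · rintro ⟨ψ, rfl⟩
      exact ⟨_, ⟨_, ⟨ψ, mem_univ _, rfl⟩, rfl⟩, rfl⟩
  refine ⟨image_mono (FacePairing.family_subset hμ), ?_, ?_, ?_⟩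
  · rw [dualProj_image_sUnion_normalFan hP, hrange]
    refine isConeSubdivision_range (E := KerDual π) ?_
      (fun ψ => exists_fg_dualProj hP π (hface ψ)) hri hfaces
    rw [← hrange]
    exact (((finite_faces hP).subset (FacePairing.family_subset hμ)).image _).image _
  · rintro _ ⟨F, hF, rfl⟩ _ ⟨G, hG, rfl⟩ h
    -- A relative interior point of the common image recovers both faces.
    obtain ⟨ψ, hψ⟩ := FacePairing.riB_nonempty (D := facePairing π hP)
      (FacePairing.family_subset hμ hF)
    have h' : dualProj π '' normalCone P F = dualProj π '' normalCone P G := h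
    have hψG : ψ ∈ intrinsicInterior ℝ (dualProj π '' normalCone P G) := h' ▸ hψ
    rw [hμ.eq_F hF hψ, hμ.eq_F hG hψG]
  · rintro _ ⟨_, ⟨ψ, -, rfl⟩, rfl⟩ _ ⟨_, ⟨χ, -, rfl⟩, rfl⟩
    refine ⟨fun h => ?_, fun h => image_mono (h.trans_subset inter_subset_right)⟩
    have hψ := h (intrinsicInterior_subset (hri ψ))
    obtain ⟨q, -, h₁, h₂⟩ := hμ.exists_common (mem_univ χ) hψ
    refine Subset.antisymm (subset_inter (subset_preimage_image _ _)
      (normalCone_anti (hμ.le (mem_univ χ) hψ))) ?_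
    rintro l ⟨hl, hl'⟩
    exact mem_normalCone_of_dualProj_mem hP (hface ψ) (intrinsicInterior_subset h₁) h₂ hl' hl

/-- If the image of `N(P, G)` is a face of the image of `N(P, F)` and `N(P, G)` is the part of
`N(P, F)` over it, then every point of `ri F` can be moved along `ker π` to a point of `ri G`. -/
theorem ri_image_subset_of_isFace_dualProj_image (hF : IsFace P F) (hG : IsFace P G)
    (hface : IsFace (dualProj π '' normalCone P F) (dualProj π '' normalCone P G))
    (hlift : normalCone P G = dualProj π ⁻¹' (dualProj π '' normalCone P G) ∩ normalCone P F) :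
    intrinsicInterior ℝ (π '' F) ⊆ intrinsicInterior ℝ (π '' G) := by
  rw [ri_image hP hF, ri_image hP hG]
  rintro _ ⟨x, hx, rfl⟩
  have hN : ∀ l, x ∈ l.toExposed P → l ∈ normalCone P F := fun l =>
    (hF.mem_normalCone_iff hP hx).2
  have hxF := intrinsicInterior_subset hx
  obtain ⟨-, k, hk⟩ := isFace_iff_exists_eval.1 hface
  have hzero : ∀ m ∈ normalCone P G, m (k : V) = 0 := by
    intro m hm
    have hm' := ((hk _).1 (mem_image_of_mem _ hm)).2
    have h₁ := hm' 0 (zero_mem_dualProj_image hF.subset)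
    have hmF : m ∈ normalCone P F := (hlift.le hm).2
    -- Comparison with `0` and with `m + m` shows that the maximum of evaluation at `k` on the cone
    -- is `0`.
    have h₂ := hm' (dualProj π (m + m)) ⟨_, fun z hz => ⟨hF.subset hz, fun w hw =>
      add_le_add ((hmF hz).2 w hw) ((hmF hz).2 w hw)⟩, rfl⟩
    rw [dualProj_apply, dualProj_apply, add_apply] at h₂
    rw [dualProj_apply, zero_apply] at h₁
    linarith
  obtain ⟨_, n, hn⟩ := id hG
  have hnG : n ∈ normalCone P G := hn.le
  have hnt := ((hk _).1 (mem_image_of_mem _ hnG)).2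
  obtain ⟨ε, hε, h⟩ := exists_add_smul_mem_polytope hP (hF.subset hxF) (v := (k : V))
    fun l hl => by
      have := hnt _ (mem_image_of_mem _ (hN l hl))
      rwa [dualProj_apply, dualProj_apply, hzero n hnG] at this
  -- Half the step puts the point between `x` and `x + ε k`, both in `P`, so any functional maximal
  -- there vanishes on `k` and is maximal at `x` too.
  have hy : x + (ε / 2) • (k : V) ∈ P := by
    convert hP.convex (hF.subset hxF) h (a := 1 / 2) (b := 1 / 2) (by norm_num) (by norm_num)
      (by norm_num) using 1
    module
  refine ⟨x + (ε / 2) • (k : V), (hG.mem_ri_iff hP).2 ⟨?_, ?_⟩, map_add_ker ((ε / 2) • k)⟩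
  · have hnF : n ∈ normalCone P F := (hlift.le hnG).2
    rw [hn]
    refine ⟨hy, fun z hz => ((hnF hxF).2 z hz).trans_eq ?_⟩
    rw [map_add, map_smul, hzero n hnG, smul_zero, add_zero]
  · rintro _ ⟨_, m, rfl⟩ hmy
    have h₁ := hmy.2 _ (hF.subset hxF)
    have h₂ := hmy.2 _ h
    simp only [map_add, map_smul, smul_eq_mul] at h₁ h₂
    have h₃ : m (k : V) = 0 := by nlinarith
    have hmF : m ∈ normalCone P F := hN m ⟨hF.subset hxF, fun z hz => (hmy.2 z hz).trans_eq (by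
      rw [map_add, map_smul, h₃, smul_zero, add_zero])⟩
    have hmG : dualProj π m ∈ dualProj π '' normalCone P G := by
      refine (hk _).2 ⟨mem_image_of_mem _ hmF, fun χ hχ => (hnt χ hχ).trans_eq ?_⟩
      rw [dualProj_apply, dualProj_apply, hzero n hnG, h₃]
    exact hlift.ge ⟨hmG, hmF⟩

/-- Each `ψ` lies in the relative interior of the image of exactly one member `N(P, F ψ)`. Any
choice of `μ ψ ∈ relint π(F ψ)` is coherent, since relative interiors of the images only grow when
passing to a face of the fan. -/
theorem exists_coherent_of_isCostring {C : Set (Set (V →L[ℝ] ℝ))}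
    (hC : IsCostring π (normalFan P) C) :
    ∃ μ, (facePairing π hP).swap.Coherent μ ∧
      C = conesOf P ((facePairing π hP).swap.family μ) := by
  have hex : ∀ ψ : KerDual π, ∃ F, IsFace P F ∧ normalCone P F ∈ C ∧
      ψ ∈ intrinsicInterior ℝ (dualProj π '' normalCone P F) := fun ψ => by
    have hψX : ψ ∈ dualProj π '' ⋃₀ normalFan P := by
      rw [dualProj_image_sUnion_normalFan hP]
      exact mem_univ ψ
    obtain ⟨_, ⟨s, hs, rfl⟩, hψ⟩ :=
      IsConeSubdivision.exists_mem_ri (E := KerDual π) hC.subdivision hψX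
    obtain ⟨F, hF, rfl⟩ := hC.subset hs
    exact ⟨F, hF, hs, hψ⟩
  choose F hF hFC hFψ using hex
  have huniq : ∀ ψ G, IsFace P G → normalCone P G ∈ C →
      ψ ∈ intrinsicInterior ℝ (dualProj π '' normalCone P G) → G = F ψ := fun ψ G hG hGC hψ =>
    injOn_normalCone hG (hF ψ) (hC.noRepetition hGC (hFC ψ)
      (hC.subdivision.eq_of_mem_ri (mem_image_of_mem _ hGC) (mem_image_of_mem _ (hFC ψ)) hψ
        (hFψ ψ)))
  have hne : ∀ ψ, (intrinsicInterior ℝ (π '' F ψ)).Nonempty := fun ψ => by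
    rw [ri_image hP (hF ψ)]
    exact ((hF ψ).exists_mem_ri hP).image π
  choose μ hμ using hne
  have heq : ∀ ψ q, q ∈ intrinsicInterior ℝ (π '' F ψ) → minFace P π q ψ = F ψ := fun ψ q hq =>
    FacePairing.F_eq (D := facePairing π hP) (hF ψ) hq (hFψ ψ)
  refine ⟨μ, ⟨fun ψ _ => image_mono (hF ψ).subset (intrinsicInterior_subset (hμ ψ)),
    fun ψ _ φ hφ => ?_⟩, ?_⟩
  · refine (heq φ (μ ψ) ?_).trans (heq φ (μ φ) (hμ φ)).symm
    have hφm : φ ∈ dualProj π '' normalCone P (F ψ) :=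
      hφ.2 (F ψ) (hF ψ) (intrinsicInterior_subset (hFψ ψ))
    obtain ⟨h₁, h₂⟩ := hC.subdivision.inter_face _ (mem_image_of_mem _ (hFC ψ)) _
      (mem_image_of_mem _ (hFC φ))
    have hsub : dualProj π '' normalCone P (F φ) ⊆ dualProj π '' normalCone P (F ψ) :=
      (h₂.subset_of_mem_ri subset_rfl (hFψ φ)
        ⟨hφm, intrinsicInterior_subset (hFψ φ)⟩).trans inter_subset_left
    rw [inter_eq_self_of_subset_right hsub] at h₁
    exact ri_image_subset_of_isFace_dualProj_image hP (hF ψ) (hF φ) h₁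
      ((hC.lift _ (hFC φ) _ (hFC ψ)).1 hsub) (hμ ψ)
  · ext s
    constructor
    · intro hs
      obtain ⟨G, hG, rfl⟩ := hC.subset hs
      obtain ⟨ψ, hψ⟩ := FacePairing.riB_nonempty (D := facePairing π hP) hG
      refine ⟨G, ⟨ψ, mem_univ _, ?_⟩, rfl⟩
      exact (huniq ψ G hG hs hψ).trans (heq ψ _ (hμ ψ)).symm
    · rintro ⟨_, ⟨ψ, -, rfl⟩, rfl⟩
      have : (facePairing π hP).swap.F ψ (μ ψ) = F ψ := heq ψ _ (hμ ψ)
      rw [this]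
      exact hFC ψ

theorem costrings_eq_image : costrings P π = conesOf P '' virtualCells P π := by
  ext C
  constructor
  · intro hC
    obtain ⟨μ, hμ, rfl⟩ := exists_coherent_of_isCostring hP hC
    exact ⟨_, (mem_virtualCells_iff hP).2 ⟨μ, hμ, rfl⟩, rfl⟩
  · rintro ⟨A, hA, rfl⟩
    obtain ⟨μ, hμ, rfl⟩ := (mem_virtualCells_iff hP).1 hA
    exact isCostring_of_coherent hP hμ

end Costrings

/-! ### Transfer of orders -/

section OrderLemmas

variable {α β ι γ : Type*} {A : Set α} {B : Set β} {r : α → α → Prop} {s : β → β → Prop}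
  {f : α → β}

theorem IsAntiIsoOn.isPartialOrderOn (h : IsAntiIsoOn f A r B s) (hr : IsPartialOrderOn A r) :
    IsPartialOrderOn B s := by
  have key : ∀ b ∈ B, ∃ a ∈ A, f a = b := fun b hb => h.bijOn.surjOn hb
  refine ⟨fun b hb => ?_, fun b hb b' hb' b'' hb'' h₁ h₂ => ?_, fun b hb b' hb' h₁ h₂ => ?_⟩
  · obtain ⟨a, ha, rfl⟩ := key b hb
    exact (h.rev a ha a ha).1 (hr.refl a ha)
  · obtain ⟨a, ha, rfl⟩ := key b hb
    obtain ⟨a', ha', rfl⟩ := key b' hb'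
    obtain ⟨a'', ha'', rfl⟩ := key b'' hb''
    rw [← h.rev _ ha' _ ha] at h₁
    rw [← h.rev _ ha'' _ ha'] at h₂
    exact (h.rev a'' ha'' a ha).1 (hr.trans _ ha'' _ ha' _ ha h₂ h₁)
  · obtain ⟨a, ha, rfl⟩ := key b hb
    obtain ⟨a', ha', rfl⟩ := key b' hb'
    rw [← h.rev _ ha' _ ha] at h₁
    rw [← h.rev _ ha _ ha'] at h₂
    rw [hr.antisymm _ ha _ ha' h₂ h₁]

/-- Cells and cones are handled through the points that define them. Reflexivity of `s` on the image
comes from `c i ⊆ c i`, which yields injectivity without assuming that `s` is an order. -/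
theorem isAntiIsoOn_image_subset {S : Set ι} {c : ι → Set γ} {d : ι → β} {g : Set γ → β}
    (hg : ∀ i ∈ S, g (c i) = d i) (h : ∀ i ∈ S, ∀ j ∈ S, (c i ⊆ c j ↔ s (d j) (d i))) :
    IsAntiIsoOn g (c '' S) (· ⊆ ·) (d '' S) s := by
  refine ⟨⟨?_, ?_, ?_⟩, ?_⟩
  · rintro _ ⟨i, hi, rfl⟩
    exact ⟨i, hi, (hg i hi).symm⟩
  · rintro _ ⟨i, hi, rfl⟩ _ ⟨j, hj, rfl⟩ heq
    rw [hg i hi, hg j hj] at heq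
    have hrefl := (h i hi i hi).1 subset_rfl
    exact Subset.antisymm ((h i hi j hj).2 (heq ▸ hrefl)) ((h j hj i hi).2 (heq ▸ hrefl))
  · rintro _ ⟨i, hi, rfl⟩
    exact ⟨_, ⟨i, hi, rfl⟩, hg i hi⟩
  · rintro _ ⟨i, hi, rfl⟩ _ ⟨j, hj, rfl⟩
    rw [hg i hi, hg j hj]
    exact h i hi j hj

theorem isEmbeddingOn_image_subset {S : Set ι} {c : ι → Set γ} {d : ι → β} {g : Set γ → β}
    (hg : ∀ i ∈ S, g (c i) = d i) (hd : ∀ i ∈ S, d i ∈ B)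
    (h : ∀ i ∈ S, ∀ j ∈ S, (c i ⊆ c j ↔ s (d i) (d j))) :
    IsEmbeddingOn g (c '' S) (· ⊆ ·) B s := by
  refine ⟨?_, ?_, ?_⟩
  · rintro _ ⟨i, hi, rfl⟩
    exact hg i hi ▸ hd i hi
  · rintro _ ⟨i, hi, rfl⟩ _ ⟨j, hj, rfl⟩ heq
    rw [hg i hi, hg j hj] at heq
    have hrefl := (h i hi i hi).1 subset_rfl
    exact Subset.antisymm ((h i hi j hj).2 (heq ▸ hrefl)) ((h j hj i hi).2 (heq ▸ hrefl))
  · rintro _ ⟨i, hi, rfl⟩ _ ⟨j, hj, rfl⟩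
    rw [hg i hi, hg j hj]
    exact h i hi j hj

end OrderLemmas

/-! ### Passing between faces and normal cones -/

section Correspondence

variable {V : Type*} [NormedAddCommGroup V] [NormedSpace ℝ V] {P : Set V}
  {A : Set (Set V)} {C : Set (Set (V →L[ℝ] ℝ))} {S : Set (Set (Set V))}

theorem facesOf_conesOf (hA : A ⊆ faces P) : facesOf P (conesOf P A) = A := by
  ext F
  constructor
  · rintro ⟨hF, G, hG, h⟩
    exact injOn_normalCone (hA hG) hF h ▸ hG
  · exact fun hF => ⟨hA hF, mem_image_of_mem _ hF⟩

theorem conesOf_facesOf (hC : C ⊆ normalFan P) : conesOf P (facesOf P C) = C := by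
  ext s
  constructor
  · rintro ⟨F, hF, rfl⟩
    exact hF.2
  · intro hs
    obtain ⟨F, hF, rfl⟩ := hC hs
    exact ⟨F, ⟨hF, hs⟩, rfl⟩

theorem facesOf_subset : facesOf P C ⊆ faces P := fun _ hF => hF.1

theorem mem_iff_conesOf_mem (hS : ∀ A ∈ S, A ⊆ faces P) (hA : A ⊆ faces P) :
    A ∈ S ↔ conesOf P A ∈ conesOf P '' S :=
  ⟨fun h => mem_image_of_mem _ h, fun ⟨_, hB, h⟩ => injOn_conesOf (hS _ hB) hA h ▸ hB⟩

theorem mem_iff_facesOf_mem (hS : ∀ A ∈ S, A ⊆ faces P) (hC : C ⊆ normalFan P) :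
    C ∈ conesOf P '' S ↔ facesOf P C ∈ S := by
  rw [mem_iff_conesOf_mem hS facesOf_subset, conesOf_facesOf hC]

variable {r : Set (Set V) → Set (Set V) → Prop}
  {s : Set (Set (V →L[ℝ] ℝ)) → Set (Set (V →L[ℝ] ℝ)) → Prop}

theorem isAntiIsoOn_conesOf (hS : ∀ A ∈ S, A ⊆ faces P)
    (h : ∀ A ∈ S, ∀ A' ∈ S, (r A A' ↔ s (conesOf P A') (conesOf P A))) :
    IsAntiIsoOn (conesOf P) S r (conesOf P '' S) s :=
  ⟨⟨mapsTo_image _ _, injOn_conesOf.mono hS, surjOn_image _ _⟩, h⟩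

theorem isAntiIsoOn_facesOf (hS : ∀ A ∈ S, A ⊆ faces P)
    (h : ∀ A ∈ S, ∀ A' ∈ S, (r A A' ↔ s (conesOf P A') (conesOf P A))) :
    IsAntiIsoOn (facesOf P) (conesOf P '' S) s S r := by
  have hinv : ∀ A ∈ S, facesOf P (conesOf P A) = A := fun A hA => facesOf_conesOf (hS A hA)
  refine ⟨⟨?_, ?_, fun A hA => ⟨_, mem_image_of_mem _ hA, hinv A hA⟩⟩, ?_⟩
  · rintro _ ⟨A, hA, rfl⟩
    rwa [hinv A hA]
  · rintro _ ⟨A, hA, rfl⟩ _ ⟨A', hA', rfl⟩ heq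
    rw [hinv A hA, hinv A' hA'] at heq
    rw [heq]
  · rintro _ ⟨A, hA, rfl⟩ _ ⟨A', hA', rfl⟩
    rw [hinv A hA, hinv A' hA']
    exact (h A' hA' A hA).symm

end Correspondence

/-! ### The four posets and their coherent members -/

section Posets

section

variable {V W : Type*} [NormedAddCommGroup V] [NormedSpace ℝ V]
  [NormedAddCommGroup W] [NormedSpace ℝ W] {P : Set V} {π : V →L[ℝ] W}

theorem conesOf_stringOfCone (σ : Set (KerDual π)) :
    conesOf P (stringOfCone P π σ) = virtualConeOfCone P π σ := by
  unfold stringOfCone virtualConeOfCone coherentString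
  simp only [conesOf, image_iUnion₂]
  simp only [← conesOf_stringOf, conesOf]

end

variable {V W : Type*} [NormedAddCommGroup V] [NormedSpace ℝ V] [FiniteDimensional ℝ V]
  [NormedAddCommGroup W] [NormedSpace ℝ W] [FiniteDimensional ℝ W]
  {P : Set V} {π : V →L[ℝ] W} {q p : W} {ψ φ : KerDual π}

variable (hP : IsPolytope P)
include hP

theorem unionLE_iff_virtualConeLE : ∀ A ∈ strings P π, ∀ A' ∈ strings P π,
    (UnionLE A A' ↔ VirtualConeLE P π (conesOf P A') (conesOf P A)) := by
  intro A hA A' hA'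
  obtain ⟨Φ, hΦ, rfl⟩ := (mem_strings_iff hP).1 hA
  obtain ⟨Φ', hΦ', rfl⟩ := (mem_strings_iff hP).1 hA'
  rw [unionLE_family_iff hP hΦ hΦ', virtualConeLE_iff hP hΦ' hΦ]

theorem virtualCellLE_iff_unionLE : ∀ A ∈ virtualCells P π, ∀ A' ∈ virtualCells P π,
    (VirtualCellLE P π A A' ↔ UnionLE (conesOf P A') (conesOf P A)) := by
  intro A hA A' hA'
  obtain ⟨μ, hμ, rfl⟩ := (mem_virtualCells_iff hP).1 hA
  obtain ⟨μ', hμ', rfl⟩ := (mem_virtualCells_iff hP).1 hA'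
  rw [virtualCellLE_iff hP hμ hμ', unionLE_conesOf_family_iff hP hμ' hμ]

theorem isPartialOrderOn_strings : IsPartialOrderOn (strings P π) UnionLE := by
  refine ⟨fun A _ => subset_rfl, fun A _ B _ C _ h h' => Subset.trans h h',
    fun A hA A' hA' h h' => ?_⟩
  obtain ⟨Φ, hΦ, rfl⟩ := (mem_strings_iff hP).1 hA
  obtain ⟨Φ', hΦ', rfl⟩ := (mem_strings_iff hP).1 hA'
  rw [unionLE_family_iff hP hΦ hΦ'] at h
  rw [unionLE_family_iff hP hΦ' hΦ] at h'
  exact FacePairing.family_congr fun q hq => Subset.antisymm (h q hq) (h' q hq)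

theorem isPartialOrderOn_costrings : IsPartialOrderOn (costrings P π) UnionLE := by
  refine ⟨fun A _ => subset_rfl, fun A _ B _ C _ h h' => Subset.trans h h',
    fun A hA A' hA' h h' => ?_⟩
  obtain ⟨μ, hμ, rfl⟩ := exists_coherent_of_isCostring hP hA
  obtain ⟨μ', hμ', rfl⟩ := exists_coherent_of_isCostring hP hA'
  rw [unionLE_conesOf_family_iff hP hμ hμ'] at h
  rw [unionLE_conesOf_family_iff hP hμ' hμ] at h'
  rw [FacePairing.family_congr fun ψ _ => Subset.antisymm (h' ψ) (h ψ)]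

theorem coherentString_mem_strings : coherentString P π ψ ∈ strings P π :=
  (mem_strings_iff hP).2 ⟨_, FacePairing.coherent_const (mem_univ ψ), coherentString_eq hP⟩

theorem coneOf_subset_iff :
    coneOf P π ψ ⊆ coneOf P π φ ↔ UnionLE (coherentString P π φ) (coherentString P π ψ) := by
  rw [coherentString_eq hP, coherentString_eq hP,
    unionLE_family_iff hP (FacePairing.coherent_const (mem_univ φ))
      (FacePairing.coherent_const (mem_univ ψ)), coneOf_eq_cell hP, coneOf_eq_cell hP]
  have h := FacePairing.mem_cell_iff_le (D := (facePairing π hP).swap) (q := φ) (p := ψ)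
    (mem_univ φ)
  constructor
  · exact fun hsub => (h.1 (hsub (FacePairing.mem_cell_self (mem_univ ψ)))).2
  · exact fun hle => FacePairing.cell_subset (h.2 ⟨mem_univ ψ, hle⟩)

/-- All terms of the union coincide, since points of the relative interior of a cone define the same
minimal faces. -/
theorem stringOfCone_coneOf : stringOfCone P π (coneOf P π ψ) = coherentString P π ψ := by
  have key : ∀ φ ∈ intrinsicInterior ℝ (coneOf P π ψ),
      coherentString P π φ = coherentString P π ψ := by
    intro φ hφ
    rw [coneOf_eq_cell hP] at hφ
    rw [coherentString_eq hP, coherentString_eq hP]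
    exact FacePairing.family_congr
      ((FacePairing.mem_ri_cell_iff (D := (facePairing π hP).swap) (mem_univ ψ)).1 hφ).2
  refine Subset.antisymm (iUnion₂_subset fun φ hφ => (key φ hφ).subset) ?_
  exact subset_iUnion₂_of_subset ψ (mem_ri_coneOf_self hP) subset_rfl

theorem coherent_const_swap (hq : q ∈ π '' P) : (facePairing π hP).swap.Coherent fun _ => q :=
  FacePairing.coherent_const (D := (facePairing π hP).swap) hq

theorem coherentCostring_eq :
    coherentCostring P π q = conesOf P ((facePairing π hP).swap.family fun _ => q) := by
  ext s
  constructor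
  · rintro ⟨ψ, rfl⟩
    exact ⟨_, ⟨ψ, mem_univ _, rfl⟩, rfl⟩
  · rintro ⟨_, ⟨ψ, -, rfl⟩, rfl⟩
    exact ⟨ψ, rfl⟩

theorem coherentCostring_mem_costrings (hq : q ∈ π '' P) :
    coherentCostring P π q ∈ costrings P π := by
  rw [coherentCostring_eq hP]
  exact isCostring_of_coherent hP (coherent_const_swap hP hq)

theorem cellOf_subset_iff (hq : q ∈ π '' P) (hp : p ∈ π '' P) :
    cellOf P π q ⊆ cellOf P π p ↔
      ∀ ψ : KerDual π, minFace P π q ψ ⊆ minFace P π p ψ := by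
  rw [cellOf_eq_cell hP hq, cellOf_eq_cell hP hp]
  have h := FacePairing.mem_cell_iff_le (D := facePairing π hP) (q := p) (p := q) hp
  constructor
  · exact fun hsub ψ => (h.1 (hsub (FacePairing.mem_cell_self hq))).2 ψ (mem_univ ψ)
  · exact fun hle => FacePairing.cell_subset (h.2 ⟨hq, fun ψ _ => hle ψ⟩)

theorem family_const_eq_of_mem_ri (hq : q ∈ π '' P)
    (hp : p ∈ intrinsicInterior ℝ (cellOf P π q)) :
    ((facePairing π hP).swap.family fun _ => p) = (facePairing π hP).swap.family fun _ => q := by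
  rw [cellOf_eq_cell hP hq] at hp
  exact FacePairing.family_congr ((FacePairing.mem_ri_cell_iff hq).1 hp).2

theorem costringOfCell_cellOf (hq : q ∈ π '' P) :
    costringOfCell P π (cellOf P π q) = coherentCostring P π q := by
  refine Subset.antisymm (iUnion₂_subset fun p hp => Eq.subset ?_) ?_
  · rw [coherentCostring_eq hP, coherentCostring_eq hP, family_const_eq_of_mem_ri hP hq hp]
  · exact subset_iUnion₂_of_subset q (mem_ri_cellOf_self hP hq) subset_rfl

theorem virtualCellOfCell_cellOf (hq : q ∈ π '' P) :
    virtualCellOfCell P π (cellOf P π q) = (facePairing π hP).swap.family fun _ => q := by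
  have key : ∀ p (hp : p ∈ π '' P), virtualCellOf P π (fun _ => ⟨p, hp⟩) =
      (facePairing π hP).swap.family fun _ => p :=
    fun p hp => virtualCellOf_eq_family hP fun _ _ _ => rfl
  ext F
  constructor
  · rintro ⟨p, hp, hpP, hF⟩
    rwa [key, family_const_eq_of_mem_ri hP hq hp] at hF
  · intro hF
    exact ⟨q, mem_ri_cellOf_self hP hq, hq, by rwa [key]⟩

end Posets

end FanDuality

/-! ### The main theorem -/

open FanDuality

theorem theoremA {V W : Type*} [NormedAddCommGroup V] [NormedSpace ℝ V] [FiniteDimensional ℝ V]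
    [NormedAddCommGroup W] [NormedSpace ℝ W] [FiniteDimensional ℝ W]
    (π : V →L[ℝ] W) (hπ : Function.Surjective π)
    (P : Set V) (hP : FanDuality.IsPolytope P) (hfull : affineSpan ℝ P = ⊤) :
    open FanDuality in
    -- the correspondences between collections of faces and collections of normal cones
    (∀ A ⊆ faces P, (A ∈ strings P π ↔ conesOf P A ∈ virtualCones P π)) ∧
    (∀ A ⊆ faces P, (A ∈ virtualCells P π ↔ conesOf P A ∈ costrings P π)) ∧
    (∀ C ⊆ normalFan P, (C ∈ costrings P π ↔ facesOf P C ∈ virtualCells P π)) ∧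
    (∀ C ⊆ normalFan P, (C ∈ virtualCones P π ↔ facesOf P C ∈ strings P π)) ∧
    -- members of the four posets are collections of faces, respectively of normal cones
    (∀ A ∈ strings P π, A ⊆ faces P) ∧ (∀ A ∈ virtualCells P π, A ⊆ faces P) ∧
    (∀ C ∈ virtualCones P π, C ⊆ normalFan P) ∧ (∀ C ∈ costrings P π, C ⊆ normalFan P) ∧
    -- the four orders are partial orders
    IsPartialOrderOn (strings P π) UnionLE ∧
    IsPartialOrderOn (virtualCones P π) (VirtualConeLE P π) ∧
    IsPartialOrderOn (costrings P π) UnionLE ∧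
    IsPartialOrderOn (virtualCells P π) (VirtualCellLE P π) ∧
    -- the correspondences reverse the orders
    IsAntiIsoOn (conesOf P) (strings P π) UnionLE (virtualCones P π) (VirtualConeLE P π) ∧
    IsAntiIsoOn (facesOf P) (virtualCones P π) (VirtualConeLE P π) (strings P π) UnionLE ∧
    IsAntiIsoOn (conesOf P) (virtualCells P π) (VirtualCellLE P π) (costrings P π) UnionLE ∧
    IsAntiIsoOn (facesOf P) (costrings P π) UnionLE (virtualCells P π) (VirtualCellLE P π) ∧
    -- they extend the anti-isomorphism between `Γ^*` and `T_coh`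
    coherentStrings P π ⊆ strings P π ∧
    IsAntiIsoOn (stringOfCone P π) (cones P π) (· ⊆ ·) (coherentStrings P π) UnionLE ∧
    IsEmbeddingOn (virtualConeOfCone P π) (cones P π) (· ⊆ ·)
      (virtualCones P π) (VirtualConeLE P π) ∧
    (∀ σ ∈ cones P π, conesOf P (stringOfCone P π σ) = virtualConeOfCone P π σ) ∧
    -- they extend the anti-isomorphism between `Γ` and `T^*_coh`
    coherentCostrings P π ⊆ costrings P π ∧
    IsAntiIsoOn (costringOfCell P π) (cells P π) (· ⊆ ·) (coherentCostrings P π) UnionLE ∧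
    IsEmbeddingOn (virtualCellOfCell P π) (cells P π) (· ⊆ ·)
      (virtualCells P π) (VirtualCellLE P π) ∧
    (∀ c ∈ cells P π, conesOf P (virtualCellOfCell P π c) = costringOfCell P π c) := by
  have hS : ∀ A ∈ strings P π, A ⊆ faces P := fun _ => strings_subset hP
  have hS' : ∀ A ∈ virtualCells P π, A ⊆ faces P := fun _ => virtualCells_subset hP
  have hrev := unionLE_iff_virtualConeLE hP (π := π)
  have hrev' := virtualCellLE_iff_unionLE hP (π := π)
  have hcones : cones P π = coneOf P π '' univ := image_univ.symm
  have hcoh : coherentStrings P π = coherentString P π '' univ := image_univ.symm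
  have h₁ := isAntiIsoOn_conesOf hS hrev
  have h₂ := isAntiIsoOn_facesOf hS hrev
  have h₃ := isAntiIsoOn_conesOf hS' hrev'
  have h₄ := isAntiIsoOn_facesOf hS' hrev'
  rw [← virtualCones_eq_image] at h₁ h₂
  rw [← costrings_eq_image hP] at h₃ h₄
  refine ⟨fun A hA => ?_, fun A hA => ?_, fun C hC => ?_, fun C hC => ?_, hS, hS', ?_,
    fun C hC => hC.subset, isPartialOrderOn_strings hP,
    h₁.isPartialOrderOn (isPartialOrderOn_strings hP), isPartialOrderOn_costrings hP,
    h₄.isPartialOrderOn (isPartialOrderOn_costrings hP), h₁, h₂, h₃, h₄, ?_, ?_, ?_,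
    fun σ _ => conesOf_stringOfCone σ, ?_, ?_, ?_, ?_⟩
  · rw [virtualCones_eq_image, mem_iff_conesOf_mem hS hA]
  · rw [costrings_eq_image hP, mem_iff_conesOf_mem hS' hA]
  · rw [costrings_eq_image hP, mem_iff_facesOf_mem hS' hC]
  · rw [virtualCones_eq_image, mem_iff_facesOf_mem hS hC]
  · rw [virtualCones_eq_image]
    rintro _ ⟨A, hA, rfl⟩
    exact image_mono (hS A hA)
  · rintro _ ⟨ψ, rfl⟩
    exact coherentString_mem_strings hP
  · rw [hcones, hcoh]
    exact isAntiIsoOn_image_subset (fun ψ _ => stringOfCone_coneOf hP)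
      fun ψ _ φ _ => coneOf_subset_iff hP
  · rw [hcones]
    -- Both the anti-isomorphism onto coherent strings and the passage to normal cones reverse
    -- order, so their composite preserves it.
    refine isEmbeddingOn_image_subset (d := fun ψ => conesOf P (coherentString P π ψ))
      (fun ψ _ => ?_) (fun ψ _ => h₁.bijOn.mapsTo (coherentString_mem_strings hP))
      fun ψ _ φ _ => ?_
    · rw [← conesOf_stringOfCone, stringOfCone_coneOf hP]
    · rw [coneOf_subset_iff hP]
      exact hrev _ (coherentString_mem_strings hP) _ (coherentString_mem_strings hP)
  · rintro _ ⟨q, hq, rfl⟩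
    exact coherentCostring_mem_costrings hP hq
  · refine isAntiIsoOn_image_subset (fun q hq => costringOfCell_cellOf hP hq)
      fun q hq p hp => ?_
    rw [cellOf_subset_iff hP hq hp, coherentCostring_eq hP, coherentCostring_eq hP,
      unionLE_conesOf_family_iff hP (coherent_const_swap hP hp) (coherent_const_swap hP hq)]
  · refine isEmbeddingOn_image_subset (fun q hq => virtualCellOfCell_cellOf hP hq)
      (fun q hq => (mem_virtualCells_iff hP).2 ⟨_, coherent_const_swap hP hq, rfl⟩)
      fun q hq p hp => ?_
    rw [cellOf_subset_iff hP hq hp,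
      virtualCellLE_iff hP (coherent_const_swap hP hq) (coherent_const_swap hP hp)]
  · rintro _ ⟨q, hq, rfl⟩
    rw [virtualCellOfCell_cellOf hP hq, costringOfCell_cellOf hP hq, coherentCostring_eq hP]
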